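/- Let $A$ and $B$ be Noetherian commutative rings, each of which is either a local ring with maximal ideal $\mathfrak m$, or a graded ring $\bigoplus_{n\ge 0}R_n$ with $R_0$ a field, in which case $\mathfrak m=\bigoplus_{n>0}R_n$ denotes its graded maximal ideal. Assume that $A$ and $B$ are Cohen--Macaulay. For such a ring $R$, with $d=\operatorname{ht}\mathfrak m$ (which equals $\dim R$), let $e(R)$ be its multiplicity with respect to $\mathfrak m$, i.e. $d!$ times the coefficient of $n^d$ in the polynomial that equals the length $\ell_R(R/\mathfrak m^{n+1})$ for all large $n$; and let $r(R)=\dim_{R/\mathfrak m}\operatorname{Ext}^d_R(R/\mathfrak m,R)$ be its Cohen--Macaulay type. Suppose that $e(A)>1$ and $e(B)>1$. If there exist real numbers $\gamma_1,\gamma_2\ge 0$ such that $$r(A)\le \gamma_1+1,\qquad r(B)\le \gamma_2+1,\qquad e(B)\gamma_1+e(A)\gamma_2\le r(A)r(B)-1,$$ then $A$ and $B$ are Gorenstein and $\gamma_1=\gamma_2=0$. Here a Noetherian ring is Cohen--Macaulay (resp. Gorenstein) if its localization at every maximal ideal is, i.e. has depth equal to its Krull dimension (resp. has finite injective dimension as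 a module over itself). -/

import Mathlib

open Filter CategoryTheory

universe u v

/-- `IsLocalOrGraded R m`: the commutative ring `R` is either a local ring and `m` is its maximal
ideal, or it carries a grading `R = ⨁_{n ≥ 0} R_n` with `R_0` a field and
`m = ⨁_{n > 0} R_n` is its graded maximal ideal. -/
inductive IsLocalOrGraded (R : Type u) [CommRing R] : Ideal R → Prop
  | ofLocal [IsLocalRing R] : IsLocalOrGraded R (IsLocalRing.maximalIdeal R)
  | ofGraded (𝒜 : ℕ → AddSubgroup R) [GradedRing 𝒜] (hfield : IsField (𝒜 0)) :
      IsLocalOrGraded R (HomogeneousIdeal.irrelevant 𝒜).toIdeal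

/-- The depth of a local ring: the supremum of the lengths of the `R`-regular sequences in the
maximal ideal. -/
noncomputable def localDepth (R : Type u) [CommRing R] [IsLocalRing R] : ℕ∞ :=
  ⨆ (rs : List R) (_ : (∀ x ∈ rs, x ∈ IsLocalRing.maximalIdeal R) ∧
    RingTheory.Sequence.IsRegular R rs), (rs.length : ℕ∞)

/-- A Noetherian local ring is Cohen–Macaulay if its depth equals its Krull dimension. -/
def IsCohenMacaulayLocal (R : Type u) [CommRing R] [IsLocalRing R] : Prop :=
  IsNoetherianRing R ∧ ((localDepth R : ℕ∞) : WithBot ℕ∞) = ringKrullDim R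

/-- A Noetherian ring is Cohen–Macaulay if its localizations at all maximal ideals are. -/
def IsCohenMacaulay (R : Type u) [CommRing R] : Prop :=
  IsNoetherianRing R ∧
    ∀ (p : Ideal R) [p.IsMaximal], IsCohenMacaulayLocal (Localization.AtPrime p)

/-- A Noetherian local ring is Gorenstein if it has finite injective dimension as a module over
itself. -/
def IsGorensteinLocal (R : Type u) [CommRing R] [IsLocalRing R] : Prop :=
  IsNoetherianRing R ∧ ∃ n : ℕ, HasInjectiveDimensionLE (ModuleCat.of.{u} R R) n

/-- A Noetherian ring is Gorenstein if its localizations at all maximal ideals are. -/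
def IsGorenstein (R : Type u) [CommRing R] : Prop :=
  IsNoetherianRing R ∧
    ∀ (p : Ideal R) [p.IsMaximal], IsGorensteinLocal (Localization.AtPrime p)

/-- The Hilbert–Samuel function `n ↦ ℓ_R(R / m ^ (n + 1))` of a maximal ideal `m` of a Noetherian
ring (all these lengths are then finite). -/
noncomputable def hilbertSamuelFun (R : Type u) [CommRing R] (m : Ideal R) (n : ℕ) : ℕ :=
  (Module.length R (R ⧸ m ^ (n + 1))).toNat

open Classical in
/-- The multiplicity `e(R)` of `R` with respect to the maximal ideal `m`: if `P` is the
Hilbert–Samuel polynomial, i.e. the polynomial with `P(n) = ℓ_R(R / m ^ (n + 1))` for all large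
`n`, it is `d!` times the coefficient of `X ^ d` in `P`, where `d = ht m = dim R_m`
(which is `dim R` when `R` is local, or positively graded with graded maximal ideal `m`).
For Noetherian `R` the polynomial exists; it is always unique. -/
noncomputable def ringMultiplicity (R : Type u) [CommRing R] (m : Ideal R) : ℚ :=
  if h : ∃ P : Polynomial ℚ, ∀ᶠ n : ℕ in atTop, P.eval (n : ℚ) = (hilbertSamuelFun R m n : ℚ) then
    (m.height.toNat.factorial : ℚ) * h.choose.coeff m.height.toNat
  else 0

/-- The Cohen–Macaulay type `r(R)` of a Cohen–Macaulay ring `R` with respect to the maximal ideal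
`m`: the dimension of the `R / m`-vector space `Ext^d_R(R / m, R)`, where `d = ht m = dim R_m`
(which is `dim R` when `R` is local, or positively graded with graded maximal ideal `m`).
As this `Ext` is killed by `m`, its `R / m`-dimension is its length over `R`. -/
noncomputable def cohenMacaulayType (R : Type u) [CommRing R] (m : Ideal R) : ℕ :=
  (Module.length R (Abelian.Ext.{u} (ModuleCat.of.{u} R (R ⧸ m)) (ModuleCat.of.{u} R R)
    m.height.toNat)).toNat

/-! The arithmetic core is the inequality `r(R) + 1 ≤ e(R)`, valid when `e(R) > 1`. Granting it,
`e(B)γ₁ ≥ (r(B) + 1)(r(A) - 1)` and `e(A)γ₂ ≥ (r(A) + 1)(r(B) - 1)`. These lower bounds sum to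
`2(r(A)r(B) - 1)`, while the hypothesis bounds the left sides together by `r(A)r(B) - 1`. Hence
`r(A)r(B) ≤ 1`, both types are 1, and then both `γ` vanish (`type_eq_one_of_inequality`).

For `r + 1 ≤ e` (`cohenMacaulayType_add_one_le`), localize at `m` and pass to a flat local extension
with infinite residue field and extended maximal ideal; lengths, `Ext` and hence `e` and `r` are
preserved. There a regular sequence of superficial elements exists
(`exists_isWeaklyRegular_length_eq`), and its quotient `Q` has length `e`. By dimension shifting,
`r` is the length of the socle `Hom(k, Q)`, which is a proper submodule of `Q` as soon as `Q` has
length greater than 1.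

Type at most 1 implies Gorenstein for the localization at `m`
(`isGorensteinLocal_of_length_ext_le_one`): for `Q = R/(x₁, …, x_d)` and `K` the kernel of `Q → k`,
comparing lengths in the `Ext` sequence of `0 → K → Q → k → 0` forces `Ext^{d+1}(k, R) = 0`. The
vanishing spreads to all higher degrees, to all cyclic modules by Nakayama, and so bounds the
injective dimension.

A graded ring has further maximal ideals (`isGorenstein_of_irrelevant`). For a homogeneous prime
`q`, the coaction `R → R[T;T⁻¹]` plays the role of a grading on `Ext^j(R/q, R)`: if an element
outside the irrelevant ideal kills this module, so does its degree zero part, a unit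
(`ExtMod.subsingleton_of_isHomogeneous`). Other primes are reached from their homogeneous cores by
Noetherian induction (`ExtMod.subsingleton_of_isPrime_isHomogeneous`), at the cost of one degree. -/

/-- The module `Ext^n_R(N, M)` for unbundled modules. -/
abbrev ExtMod (R : Type u) [CommRing R] (N M : Type u) [AddCommGroup N] [Module R N]
    [AddCommGroup M] [Module R M] (n : ℕ) : Type u :=
  Abelian.Ext.{u} (ModuleCat.of.{u} R N) (ModuleCat.of.{u} R M) n

/-! ### Functoriality of `Ext` and its long exact sequences -/

namespace ExtMod

section LinearMaps

variable {R : Type u} [CommRing R] {N N₁ N₂ N₃ M M₁ M₂ M₃ : Type u}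
  [AddCommGroup N] [Module R N] [AddCommGroup N₁] [Module R N₁] [AddCommGroup N₂] [Module R N₂]
  [AddCommGroup N₃] [Module R N₃] [AddCommGroup M] [Module R M] [AddCommGroup M₁] [Module R M₁]
  [AddCommGroup M₂] [Module R M₂] [AddCommGroup M₃] [Module R M₃]

variable (M) in
/-- The map on `Ext` induced by a linear map of the first variable. -/
noncomputable def pre (f : N₁ →ₗ[R] N₂) (n : ℕ) : ExtMod R N₂ M n →ₗ[R] ExtMod R N₁ M n :=
  (Abelian.Ext.mk₀ (ModuleCat.ofHom f)).precompOfLinear R (ModuleCat.of R M) (zero_add n)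

variable (N) in
/-- The map on `Ext` induced by a linear map of the second variable. -/
noncomputable def post (f : M₁ →ₗ[R] M₂) (n : ℕ) : ExtMod R N M₁ n →ₗ[R] ExtMod R N M₂ n :=
  (Abelian.Ext.mk₀ (ModuleCat.ofHom f)).postcompOfLinear R (ModuleCat.of R N) (add_zero n)

theorem pre_apply (f : N₁ →ₗ[R] N₂) (n : ℕ) (x : ExtMod R N₂ M n) :
    pre M f n x = (Abelian.Ext.mk₀ (ModuleCat.ofHom f)).comp x (zero_add n) := rfl

theorem post_apply (f : M₁ →ₗ[R] M₂) (n : ℕ) (x : ExtMod R N M₁ n) :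
    post N f n x = x.comp (Abelian.Ext.mk₀ (ModuleCat.ofHom f)) (add_zero n) := rfl

theorem pre_id (n : ℕ) : pre M (LinearMap.id : N →ₗ[R] N) n = LinearMap.id := by
  ext x
  rw [pre_apply]
  exact Abelian.Ext.mk₀_id_comp x

theorem post_id (n : ℕ) : post N (LinearMap.id : M →ₗ[R] M) n = LinearMap.id := by
  ext x
  rw [post_apply]
  exact Abelian.Ext.comp_mk₀_id x

theorem pre_comp (f : N₁ →ₗ[R] N₂) (g : N₂ →ₗ[R] N₃) (n : ℕ) :
    pre M (g ∘ₗ f) n = pre M f n ∘ₗ pre M g n := by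
  ext x
  simp only [pre_apply, LinearMap.comp_apply, ModuleCat.ofHom_comp]
  rw [← Abelian.Ext.mk₀_comp_mk₀_assoc]

theorem post_comp (f : M₁ →ₗ[R] M₂) (g : M₂ →ₗ[R] M₃) (n : ℕ) :
    post N (g ∘ₗ f) n = post N g n ∘ₗ post N f n := by
  ext x
  simp only [post_apply, LinearMap.comp_apply, ModuleCat.ofHom_comp]
  rw [← Abelian.Ext.mk₀_comp_mk₀, Abelian.Ext.comp_assoc_of_second_deg_zero]

theorem pre_smul_id (r : R) (n : ℕ) :
    pre M (r • (LinearMap.id : N →ₗ[R] N)) n = r • LinearMap.id := by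
  ext x
  rw [pre_apply, show ModuleCat.ofHom (r • (LinearMap.id : N →ₗ[R] N)) = r • 𝟙 _ from rfl, Abelian.Ext.mk₀_smul, Abelian.Ext.smul_comp]
  exact congrArg (r • ·) (Abelian.Ext.mk₀_id_comp x)

theorem post_smul_id (r : R) (n : ℕ) :
    post N (r • (LinearMap.id : M →ₗ[R] M)) n = r • LinearMap.id := by
  ext x
  rw [post_apply, show ModuleCat.ofHom (r • (LinearMap.id : M →ₗ[R] M)) = r • 𝟙 _ from rfl, Abelian.Ext.mk₀_smul, Abelian.Ext.comp_smul]
  exact congrArg (r • ·) (Abelian.Ext.comp_mk₀_id x)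

/-- `Ext` is killed by the annihilator of the first variable. -/
theorem smul_eq_zero_of_left {r : R} (hr : ∀ x : N, r • x = 0) {n : ℕ} (x : ExtMod R N M n) :
    r • x = 0 := by
  have h0 : r • (LinearMap.id : N →ₗ[R] N) = 0 := LinearMap.ext fun y => hr y
  have h := LinearMap.congr_fun (pre_smul_id (N := N) (M := M) r n) x
  rw [h0, pre_apply, ModuleCat.ofHom_zero, Abelian.Ext.mk₀_zero, Abelian.Ext.zero_comp] at h
  exact h.symm

/-- `Ext` only depends on the isomorphism class of both variables. -/
noncomputable def congr (e : N₁ ≃ₗ[R] N₂) (e' : M₁ ≃ₗ[R] M₂) (n : ℕ) :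
    ExtMod R N₁ M₁ n ≃ₗ[R] ExtMod R N₂ M₂ n :=
  LinearEquiv.ofLinearMap (post N₂ e'.toLinearMap n ∘ₗ pre M₁ e.symm.toLinearMap n)
    (pre M₁ e.toLinearMap n ∘ₗ post N₂ e'.symm.toLinearMap n)
    (by
      rw [LinearMap.comp_assoc, ← LinearMap.comp_assoc (post N₂ e'.symm.toLinearMap n), ← pre_comp]
      rw [show e.toLinearMap ∘ₗ e.symm.toLinearMap = LinearMap.id by ext; simp, pre_id,
        LinearMap.id_comp, ← post_comp,
        show e'.toLinearMap ∘ₗ e'.symm.toLinearMap = LinearMap.id by ext; simp, post_id])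
    (by
      rw [LinearMap.comp_assoc, ← LinearMap.comp_assoc (pre M₁ e.symm.toLinearMap n), ← post_comp]
      rw [show e'.symm.toLinearMap ∘ₗ e'.toLinearMap = LinearMap.id by ext; simp, post_id,
        LinearMap.id_comp, ← pre_comp,
        show e.symm.toLinearMap ∘ₗ e.toLinearMap = LinearMap.id by ext; simp, pre_id])

variable (R N M) in
/-- `Ext^0` is `Hom`. -/
noncomputable def zeroEquiv : ExtMod R N M 0 ≃ₗ[R] (N →ₗ[R] M) :=
  Abelian.Ext.linearEquiv₀.trans ModuleCat.homLinearEquiv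

theorem zeroEquiv_pre (f : N₁ →ₗ[R] N₂) (x : ExtMod R N₂ M 0) :
    zeroEquiv R N₁ M (pre M f 0 x) = zeroEquiv R N₂ M x ∘ₗ f := by
  obtain ⟨y, rfl⟩ := (Abelian.Ext.linearEquiv₀ (R := R)).symm.surjective x
  rw [pre_apply]
  simp only [zeroEquiv, LinearEquiv.trans_apply, LinearEquiv.apply_symm_apply]
  rw [Abelian.Ext.linearEquiv₀_symm_apply, Abelian.Ext.mk₀_comp_mk₀,
    ← Abelian.Ext.linearEquiv₀_symm_apply (R := R), LinearEquiv.apply_symm_apply]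
  rfl

theorem shortExact_of {f : N₁ →ₗ[R] N₂} {g : N₂ →ₗ[R] N₃} (hf : Function.Injective f)
    (hfg : Function.Exact f g) (hg : Function.Surjective g) :
    (ModuleCat.shortComplexOfCompEqZero f g hfg.linearMap_comp_eq_zero).ShortExact :=
  ModuleCat.shortComplex_shortExact _ hfg hf hg

variable (M) in
/-- The long exact sequence of `Ext` in the first variable. -/
theorem exists_contravariant {f : N₁ →ₗ[R] N₂} {g : N₂ →ₗ[R] N₃} (hf : Function.Injective f)
    (hfg : Function.Exact f g) (hg : Function.Surjective g) :
    ∃ δ : ∀ n, ExtMod R N₁ M n →ₗ[R] ExtMod R N₃ M (n + 1),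
      (∀ n, Function.Exact (pre M g n) (pre M f n)) ∧
      (∀ n, Function.Exact (pre M f n) (δ n)) ∧
      (∀ n, Function.Exact (δ n) (pre M g (n + 1))) := by
  have hS := shortExact_of hf hfg hg
  refine ⟨fun n => hS.extClass.precompOfLinear R (ModuleCat.of R M) (add_comm 1 n), fun n x => ?_,
    fun n x => ?_, fun n x => ?_⟩
  · refine ⟨fun h => Abelian.Ext.contravariant_sequence_exact₂ hS _ x h, ?_⟩
    rintro ⟨y, rfl⟩
    rw [← LinearMap.comp_apply, ← pre_comp, hfg.linearMap_comp_eq_zero, pre_apply,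
      ModuleCat.ofHom_zero, Abelian.Ext.mk₀_zero, Abelian.Ext.zero_comp]
  · refine ⟨fun h => Abelian.Ext.contravariant_sequence_exact₁ hS _ x (add_comm 1 n) h, ?_⟩
    rintro ⟨y, rfl⟩
    exact (Abelian.Ext.comp_assoc _ _ _ (add_zero 1) (zero_add n) (by omega)).symm.trans (by
      erw [hS.extClass_comp, Abelian.Ext.zero_comp])
  · refine ⟨fun h => Abelian.Ext.contravariant_sequence_exact₃ hS _ x h (add_comm 1 n), ?_⟩
    rintro ⟨y, rfl⟩
    exact (Abelian.Ext.comp_assoc _ _ _ (zero_add 1) (add_comm 1 n) (by omega)).symm.trans (by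
      erw [hS.comp_extClass, Abelian.Ext.zero_comp])

variable (N) in
/-- The long exact sequence of `Ext` in the second variable. -/
theorem exists_covariant {f : M₁ →ₗ[R] M₂} {g : M₂ →ₗ[R] M₃} (hf : Function.Injective f)
    (hfg : Function.Exact f g) (hg : Function.Surjective g) :
    ∃ δ : ∀ n, ExtMod R N M₃ n →ₗ[R] ExtMod R N M₁ (n + 1),
      (∀ n, Function.Exact (post N f n) (post N g n)) ∧
      (∀ n, Function.Exact (post N g n) (δ n)) ∧
      (∀ n, Function.Exact (δ n) (post N f (n + 1))) := by
  have hS := shortExact_of hf hfg hg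
  refine ⟨fun n => hS.extClass.postcompOfLinear R (ModuleCat.of R N) (rfl : n + 1 = n + 1),
    fun n x => ?_, fun n x => ?_, fun n x => ?_⟩
  · refine ⟨fun h => Abelian.Ext.covariant_sequence_exact₂ _ hS x h, ?_⟩
    rintro ⟨y, rfl⟩
    rw [← LinearMap.comp_apply, ← post_comp, hfg.linearMap_comp_eq_zero, post_apply,
      ModuleCat.ofHom_zero, Abelian.Ext.mk₀_zero, Abelian.Ext.comp_zero]
  · refine ⟨fun h => Abelian.Ext.covariant_sequence_exact₃ _ hS x rfl h, ?_⟩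
    rintro ⟨y, rfl⟩
    exact (Abelian.Ext.comp_assoc _ _ _ (add_zero n) (zero_add 1) (by omega)).trans (by
      erw [hS.comp_extClass, Abelian.Ext.comp_zero])
  · refine ⟨fun h => Abelian.Ext.covariant_sequence_exact₁ _ hS x h rfl, ?_⟩
    rintro ⟨y, rfl⟩
    exact (Abelian.Ext.comp_assoc _ _ _ rfl (add_zero 1) (by omega)).trans (by
      erw [hS.extClass_comp, Abelian.Ext.comp_zero])

theorem subsingleton_of_projective [Module.Projective R N] (n : ℕ) :
    Subsingleton (ExtMod R N M (n + 1)) := by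
  have : Projective (ModuleCat.of R N) :=
    (IsProjective.iff_projective (R := R) N).mp inferInstance
  exact Abelian.Ext.subsingleton_of_projective _ _ n

theorem subsingleton_of_subsingleton_left [Subsingleton N] (n : ℕ) :
    Subsingleton (ExtMod R N M n) := by
  refine subsingleton_of_forall_eq 0 fun x => ?_
  have : pre M (LinearMap.id : N →ₗ[R] N) n x = x := by rw [pre_id]; rfl
  rw [← this, pre_apply, show (LinearMap.id : N →ₗ[R] N) = 0 from
    LinearMap.ext fun y => Subsingleton.elim _ _, ModuleCat.ofHom_zero, Abelian.Ext.mk₀_zero,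
    Abelian.Ext.zero_comp]

end LinearMaps

end ExtMod

/-! ### Flat base change for `Hom` and `Ext` -/

open scoped TensorProduct

/-- Two cokernels of maps with matching ranges are isomorphic. -/
theorem LinearEquiv.nonempty_of_exact_of_exact {S A B C A' B' C' : Type*} [CommRing S]
    [AddCommGroup A] [Module S A] [AddCommGroup B] [Module S B] [AddCommGroup C] [Module S C]
    [AddCommGroup A'] [Module S A'] [AddCommGroup B'] [Module S B'] [AddCommGroup C'] [Module S C']
    {f : A →ₗ[S] B} {g : B →ₗ[S] C} {f' : A' →ₗ[S] B'} {g' : B' →ₗ[S] C'}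
    (hfg : Function.Exact f g) (hg : Function.Surjective g)
    (hfg' : Function.Exact f' g') (hg' : Function.Surjective g')
    (eA : A ≃ₗ[S] A') (eB : B ≃ₗ[S] B') (h : ∀ a, eB (f a) = f' (eA a)) :
    Nonempty (C ≃ₗ[S] C') := by
  have hmap : (LinearMap.ker g).map (eB : B →ₗ[S] B') = LinearMap.ker g' := by
    rw [hfg.linearMap_ker_eq, hfg'.linearMap_ker_eq]
    ext x
    simp only [Submodule.mem_map, LinearMap.mem_range]
    constructor
    · rintro ⟨_, ⟨a, rfl⟩, rfl⟩
      exact ⟨eA a, (h a).symm⟩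
    · rintro ⟨a, rfl⟩
      exact ⟨f (eA.symm a), ⟨_, rfl⟩, by simp [h]⟩
  exact ⟨(g.quotKerEquivOfSurjective hg).symm ≪≫ₗ Submodule.Quotient.equiv _ _ eB hmap ≪≫ₗ
    g'.quotKerEquivOfSurjective hg'⟩

section HomBaseChange

variable {R : Type*} (S : Type*) [CommRing R] [CommRing S] [Algebra R S]
  (N M : Type*) [AddCommGroup N] [Module R N] [AddCommGroup M] [Module R M]

/-- The natural map `S ⊗ Hom_R(N, M) → Hom_S(S ⊗ N, S ⊗ M)`. -/
noncomputable def homBaseChange : S ⊗[R] (N →ₗ[R] M) →ₗ[S] (S ⊗[R] N →ₗ[S] S ⊗[R] M) :=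
  LinearMap.liftBaseChange S (LinearMap.baseChangeHom R S N M)

@[simp]
theorem homBaseChange_tmul (s : S) (f : N →ₗ[R] M) :
    homBaseChange S N M (s ⊗ₜ f) = s • f.baseChange S := by
  simp [homBaseChange]

variable {N M}

theorem homBaseChange_lcomp {N' : Type*} [AddCommGroup N'] [Module R N'] (g : N' →ₗ[R] N)
    (x : S ⊗[R] (N →ₗ[R] M)) :
    homBaseChange S N' M ((LinearMap.lcomp R M g).baseChange S x) =
      homBaseChange S N M x ∘ₗ g.baseChange S := by
  induction x with
  | zero => simp
  | add x y hx hy => simp [hx, hy, LinearMap.add_comp]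
  | tmul s f =>
    rw [LinearMap.baseChange_tmul, homBaseChange_tmul, homBaseChange_tmul, LinearMap.smul_comp,
      ← LinearMap.baseChange_comp]
    rfl

variable (N M)

theorem homBaseChange_bijective_of_free [Module.Free R N] [Module.Finite R N] :
    Function.Bijective (homBaseChange (R := R) S N M) := by
  have h := IsBaseChange.linearMapLeftRight (TensorProduct.isBaseChange R N S)
    (TensorProduct.isBaseChange R M S)
  have : homBaseChange S N M = h.equiv.toLinearMap := by
    apply TensorProduct.AlgebraTensorModule.ext
    intro s f
    rw [homBaseChange_tmul, LinearEquiv.coe_coe, IsBaseChange.equiv_tmul]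
    congr 1
    apply TensorProduct.AlgebraTensorModule.ext
    intro t n
    have := IsBaseChange.linearMapLeftRightHom_comp_apply (TensorProduct.isBaseChange R N S)
      (TensorProduct.mk R S M 1) f n
    have h2 : t ⊗ₜ[R] n = t • TensorProduct.mk R S N 1 n := by
      simp [TensorProduct.smul_tmul']
    rw [h2, map_smul, map_smul, this]
    simp
  rw [this]
  exact h.equiv.bijective

variable [Module.Flat R S]

theorem lcomp_baseChange_injective {N' : Type*} [AddCommGroup N'] [Module R N'] (g : N' →ₗ[R] N)
    (hg : Function.Surjective g) :
    Function.Injective ((LinearMap.lcomp R M g).baseChange S) := by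
  apply Module.Flat.lTensor_preserves_injective_linearMap
  intro a b hab
  ext x
  obtain ⟨y, rfl⟩ := hg x
  exact LinearMap.congr_fun hab y

/-- A finite free cover of `N` embeds both sides, by left exactness of `Hom` and flatness, into the
corresponding modules for a free module, where the map is bijective. -/
theorem homBaseChange_injective [Module.Finite R N] :
    Function.Injective (homBaseChange (R := R) S N M) := by
  obtain ⟨n, g, hg⟩ := Module.Finite.exists_fin' R N
  refine (injective_iff_map_eq_zero _).mpr fun x hx => ?_
  apply lcomp_baseChange_injective S N M g hg
  rw [map_zero]
  apply (homBaseChange_bijective_of_free S (Fin n → R) M).1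
  rw [homBaseChange_lcomp, hx, map_zero, LinearMap.zero_comp]

/-- A diagram chase on a free presentation. The relation module is finite because `R` is Noetherian,
and injectivity of the comparison map for it is enough. -/
theorem homBaseChange_bijective [IsNoetherianRing R] [Module.Finite R N] :
    Function.Bijective (homBaseChange (R := R) S N M) := by
  refine ⟨homBaseChange_injective S N M, fun ψ => ?_⟩
  obtain ⟨n, g, hg⟩ := Module.Finite.exists_fin' R N
  obtain ⟨y, hy⟩ := (homBaseChange_bijective_of_free S (Fin n → R) M).2 (ψ ∘ₗ g.baseChange S)
  let f : LinearMap.ker g →ₗ[R] (Fin n → R) := (LinearMap.ker g).subtype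
  have hex : Function.Exact (LinearMap.lcomp R M g) (LinearMap.lcomp R M f) := by
    intro h
    constructor
    · intro h0
      have hle : LinearMap.ker g ≤ LinearMap.ker h := fun x hx =>
        LinearMap.congr_fun h0 (⟨x, hx⟩ : LinearMap.ker g)
      refine ⟨((LinearMap.ker g).liftQ h hle) ∘ₗ (g.quotKerEquivOfSurjective hg).symm.toLinearMap,
        ?_⟩
      refine LinearMap.ext fun x => ?_
      change (LinearMap.ker g).liftQ h hle ((g.quotKerEquivOfSurjective hg).symm (g x)) = h x
      rw [show g x = g.quotKerEquivOfSurjective hg (Submodule.Quotient.mk x) from rfl,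
        LinearEquiv.symm_apply_apply]
      rfl
    · rintro ⟨k, rfl⟩
      ext x
      simp [f]
  have hex' := Module.Flat.lTensor_exact (R := R) S hex
  obtain ⟨x, hx⟩ := (hex' y).1 (by
    apply homBaseChange_injective S (LinearMap.ker g) M
    rw [map_zero]
    refine (homBaseChange_lcomp S f y).trans ?_
    rw [hy, LinearMap.comp_assoc, ← LinearMap.baseChange_comp]
    have : g ∘ₗ f = 0 := by ext x; simp [f]
    rw [this]
    simp)
  refine ⟨x, ?_⟩
  have h2 : homBaseChange S N M x ∘ₗ g.baseChange S = ψ ∘ₗ g.baseChange S := by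
    rw [← homBaseChange_lcomp, ← hy]
    congr 1
  have hs : Function.Surjective (g.baseChange S) := LinearMap.lTensor_surjective S hg
  exact LinearMap.ext fun z => by
    obtain ⟨w, rfl⟩ := hs z
    exact LinearMap.congr_fun h2 w

end HomBaseChange

section ExtBaseChange

open scoped TensorProduct

namespace ExtMod

/-- `Ext` out of finite modules over Noetherian rings commutes with flat base change. -/
theorem nonempty_baseChange {R : Type u} (S : Type u) [CommRing R] [IsNoetherianRing R] [CommRing S]
    [Algebra R S] [Module.Flat R S] (M : Type u) [AddCommGroup M] [Module R M] (n : ℕ) :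
    ∀ (N : Type u) [AddCommGroup N] [Module R N] [Module.Finite R N],
    Nonempty (S ⊗[R] ExtMod R N M n ≃ₗ[S] ExtMod S (S ⊗[R] N) (S ⊗[R] M) n) := by
  induction n with
  | zero =>
    intro N _ _ _
    exact ⟨(zeroEquiv R N M).baseChange R S _ _ ≪≫ₗ
      LinearEquiv.ofBijective _ (homBaseChange_bijective (R := R) S N M) ≪≫ₗ
      (zeroEquiv S (S ⊗[R] N) (S ⊗[R] M)).symm⟩
  | succ n ih =>
    intro N _ _ _
    obtain ⟨m, g, hg⟩ := Module.Finite.exists_fin' R N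
    let f : LinearMap.ker g →ₗ[R] (Fin m → R) := (LinearMap.ker g).subtype
    have hf : Function.Injective f := Subtype.val_injective
    have hfg : Function.Exact f g := g.exact_subtype_ker_map
    have hf' : Function.Injective (f.baseChange S) :=
      Module.Flat.lTensor_preserves_injective_linearMap f hf
    have hfg' : Function.Exact (f.baseChange S) (g.baseChange S) :=
      Module.Flat.lTensor_exact (R := R) S hfg
    have hg' : Function.Surjective (g.baseChange S) := LinearMap.lTensor_surjective S hg
    obtain ⟨δ, -, h2, h3⟩ := exists_contravariant M hf hfg hg
    obtain ⟨δ', -, h2', h3'⟩ := exists_contravariant (S ⊗[R] M) hf' hfg' hg'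
    have hδ : Function.Surjective (δ n) := fun x =>
      (h3 n x).1 (@Subsingleton.elim _ (subsingleton_of_projective n) _ _)
    have hδ' : Function.Surjective (δ' n) := fun x =>
      (h3' n x).1 (@Subsingleton.elim _ (subsingleton_of_projective n) _ _)
    have hex := Module.Flat.lTensor_exact (R := R) S (h2 n)
    have hs : Function.Surjective ((δ n).baseChange S) := LinearMap.lTensor_surjective S hδ
    -- In degree one, `Ext` is the cokernel of restricting homomorphisms from the free module to the
    -- kernel, and both sides are compared through `homBaseChange`. In higher degrees the free
    -- module has no `Ext`, so the connecting maps are isomorphisms and the claim for the kernel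
    -- applies one degree lower.
    rcases n with _ | n
    · refine LinearEquiv.nonempty_of_exact_of_exact
        (f := (pre M f 0).baseChange S) (g := (δ 0).baseChange S) hex hs (h2' 0) hδ'
        ((zeroEquiv R _ M).baseChange R S _ _ ≪≫ₗ
          LinearEquiv.ofBijective _ (homBaseChange_bijective (R := R) S (Fin m → R) M) ≪≫ₗ
          (zeroEquiv S _ (S ⊗[R] M)).symm)
        ((zeroEquiv R _ M).baseChange R S _ _ ≪≫ₗ
          LinearEquiv.ofBijective _ (homBaseChange_bijective (R := R) S (LinearMap.ker g) M) ≪≫ₗ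
          (zeroEquiv S _ (S ⊗[R] M)).symm) fun a => ?_
      apply (zeroEquiv S _ _).injective
      rw [zeroEquiv_pre]
      simp only [LinearEquiv.trans_apply, LinearEquiv.apply_symm_apply,
        LinearEquiv.ofBijective_apply]
      rw [← homBaseChange_lcomp]
      congr 1
      induction a with
      | zero => simp
      | add x y hx hy => simp only [map_add, hx, hy]
      | tmul s x =>
        simp only [LinearMap.baseChange_tmul, LinearEquiv.baseChange_tmul]
        rw [zeroEquiv_pre]
        rfl
    · obtain ⟨e⟩ := ih (LinearMap.ker g)
      have hz : Subsingleton (ExtMod R (Fin m → R) M (n + 1)) := subsingleton_of_projective n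
      have hz' : Subsingleton (ExtMod S (S ⊗[R] (Fin m → R)) (S ⊗[R] M) (n + 1)) :=
        subsingleton_of_projective n
      have i1 : Function.Injective (δ (n + 1)) := (injective_iff_map_eq_zero _).mpr fun x hx => by
        obtain ⟨y, rfl⟩ := (h2 (n + 1) x).1 hx
        rw [Subsingleton.elim y 0, map_zero]
      have i2 : Function.Injective (δ' (n + 1)) := (injective_iff_map_eq_zero _).mpr fun x hx => by
        obtain ⟨y, rfl⟩ := (h2' (n + 1) x).1 hx
        rw [Subsingleton.elim y 0, map_zero]
      exact ⟨((LinearEquiv.ofBijective _ ⟨i1, hδ⟩).symm).baseChange R S _ _ ≪≫ₗ e ≪≫ₗ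
        LinearEquiv.ofBijective _ ⟨i2, hδ'⟩⟩

end ExtMod

end ExtBaseChange

/-! ### `Ext` and regular sequences -/

namespace ExtMod

section Regular

variable {R : Type u} [CommRing R] {N M : Type u} [AddCommGroup N] [Module R N]
  [AddCommGroup M] [Module R M]

/-- If `x` is `M`-regular and kills `N`, then multiplication by `x` splits the long exact sequence
into short exact sequences `0 → Ext^n(N, M) → Ext^n(N, M/xM) → Ext^{n+1}(N, M) → 0`. -/
theorem exists_shortExact_of_isSMulRegular {x : R} (hx : IsSMulRegular M x)
    (hN : ∀ y : N, x • y = 0) (n : ℕ) :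
    ∃ (a : ExtMod R N M n →ₗ[R] ExtMod R N (QuotSMulTop x M) n)
      (b : ExtMod R N (QuotSMulTop x M) n →ₗ[R] ExtMod R N M (n + 1)),
      Function.Injective a ∧ Function.Exact a b ∧ Function.Surjective b := by
  have hex := LinearMap.exact_lsmul_mkQ_smul_top M x
  obtain ⟨δ, h1, h2, h3⟩ := exists_covariant N (f := LinearMap.lsmul R M x) (by exact hx) hex
    (Submodule.mkQ_surjective _)
  have hz : ∀ n, post N (LinearMap.lsmul R M x) n = 0 := fun n => by
    have : LinearMap.lsmul R M x = x • LinearMap.id := rfl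
    rw [this, post_smul_id]
    exact LinearMap.ext fun z => smul_eq_zero_of_left hN z
  refine ⟨post N (Submodule.mkQ _) n, δ n, (injective_iff_map_eq_zero _).mpr fun y hy => ?_,
    h2 n, fun y => ?_⟩
  · obtain ⟨z, rfl⟩ := (h1 n y).1 hy
    rw [hz]
    rfl
  · exact (h3 n y).1 (by rw [hz]; rfl)

theorem subsingleton_quotSMulTop {x : R} (hx : IsSMulRegular M x)
    (hN : ∀ y : N, x • y = 0) (n : ℕ) (h1 : Subsingleton (ExtMod R N M n))
    (h2 : Subsingleton (ExtMod R N M (n + 1))) :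
    Subsingleton (ExtMod R N (QuotSMulTop x M) n) := by
  obtain ⟨a, b, -, hab, -⟩ := exists_shortExact_of_isSMulRegular hx hN n
  refine subsingleton_of_forall_eq 0 fun y => ?_
  obtain ⟨z, rfl⟩ := (hab y).1 (Subsingleton.elim _ _)
  rw [Subsingleton.elim z 0, map_zero]

end Regular

/-- Vanishing below, and value at, the length of a weakly regular sequence that kills `N`. -/
theorem of_isWeaklyRegular {R : Type u} [CommRing R] {N : Type u} [AddCommGroup N] [Module R N]
    (rs : List R) : ∀ (M : Type u) [AddCommGroup M] [Module R M],
    RingTheory.Sequence.IsWeaklyRegular M rs → (∀ x ∈ rs, ∀ y : N, x • y = 0) →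
    (∀ i < rs.length, Subsingleton (ExtMod R N M i)) ∧
      Nonempty (ExtMod R N M rs.length ≃ₗ[R]
        (N →ₗ[R] M ⧸ Ideal.ofList rs • (⊤ : Submodule R M))) := by
  induction rs with
  | nil =>
    intro M _ _ _ _
    refine ⟨fun i hi => absurd hi (Nat.not_lt_zero i), ⟨zeroEquiv R N M ≪≫ₗ ?_⟩⟩
    exact LinearEquiv.congrRight (Submodule.quotEquivOfEqBot _ (by simp)).symm
  | cons x rs ih =>
    intro M _ _ hreg hN
    rw [RingTheory.Sequence.isWeaklyRegular_cons_iff] at hreg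
    have hxN := hN x (by simp)
    obtain ⟨hv, ⟨e⟩⟩ := ih (QuotSMulTop x M) hreg.2 fun z hz => hN z (List.mem_cons_of_mem _ hz)
    have hlt : ∀ i < rs.length, Subsingleton (ExtMod R N M i) := fun i hi => by
      obtain ⟨a, b, ha, -, -⟩ := exists_shortExact_of_isSMulRegular hreg.1 hxN i
      have := hv i hi
      exact ha.subsingleton
    -- In degree zero this is `Hom(N, M)`, which vanishes because `x` kills `N` and is regular on
    -- `M`. Otherwise it is a quotient of `Ext` into `M/xM` one degree lower.
    have hlast : Subsingleton (ExtMod R N M rs.length) := by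
      rcases h : rs.length with _ | n
      · have : Subsingleton (N →ₗ[R] M) :=
          hreg.1.linearMap_subsingleton_of_mem_annihilator (Module.mem_annihilator.mpr hxN)
        exact (zeroEquiv R N M).injective.subsingleton
      · obtain ⟨a, b, -, -, hb⟩ := exists_shortExact_of_isSMulRegular hreg.1 hxN n
        have := hv n (by omega)
        exact hb.subsingleton
    refine ⟨fun i hi => ?_, ?_⟩
    · rcases Nat.lt_succ_iff_lt_or_eq.mp hi with h | rfl
      · exact hlt i h
      · exact hlast
    -- The left term of the short exact sequence has just been shown to vanish, so `b` is an
    -- isomorphism: passing to `M/xM` lowers the degree by one.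
    · obtain ⟨a, b, -, hab, hb⟩ := exists_shortExact_of_isSMulRegular hreg.1 hxN rs.length
      have hbi : Function.Injective b := (injective_iff_map_eq_zero _).mpr fun y hy => by
        obtain ⟨z, rfl⟩ := (hab y).1 hy
        rw [Subsingleton.elim z 0, map_zero]
      exact ⟨(LinearEquiv.ofBijective b ⟨hbi, hb⟩).symm ≪≫ₗ e ≪≫ₗ
        LinearEquiv.congrRight (Submodule.quotOfListConsSMulTopEquivQuotSMulTopInner M x rs).symm⟩

end ExtMod

/-! ### Superficial elements through the Rees algebra -/

open scoped Polynomial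

section Avoidance

open IsLocalRing

/-- Over a local ring with infinite residue field, a finite module is not a finite union of proper
submodules. -/
theorem IsLocalRing.exists_forall_notMem_of_infinite_residueField {R W : Type*} [CommRing R]
    [IsLocalRing R] [Infinite (ResidueField R)] [AddCommGroup W] [Module R W] [Module.Finite R W]
    (s : Finset (Submodule R W)) (hs : ∀ V ∈ s, V ≠ ⊤) : ∃ w : W, ∀ V ∈ s, w ∉ V := by
  by_contra! hcon
  -- B. H. Neumann's lemma: in a finite cover by subgroups one has finite index. A maximal submodule
  -- above it has quotient isomorphic to the residue field, which would then be finite.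
  obtain ⟨V, hV, hfin⟩ := Submodule.exists_finiteIndex_of_cover (s := s) (p := fun V => V) (by
    refine Set.eq_univ_of_forall fun w => ?_
    obtain ⟨V, hV, hw⟩ := hcon w
    exact Set.mem_biUnion hV hw)
  obtain ⟨U, hU, hVU⟩ := (eq_top_or_exists_le_coatom V).resolve_left (hs V hV)
  have : Finite (W ⧸ V) := AddSubgroup.finite_quotient_of_finiteIndex (H := V.toAddSubgroup)
  have hfinU : Finite (W ⧸ U) := Finite.of_surjective (Submodule.factor hVU)
    (Submodule.factor_surjective hVU)
  have : IsSimpleModule R (W ⧸ U) := isSimpleModule_iff_isCoatom.mpr hU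
  obtain ⟨m, hm, ⟨e⟩⟩ := isSimpleModule_iff_quot_maximal.mp this
  obtain rfl := eq_maximalIdeal hm
  have : Finite (ResidueField R) := Finite.of_equiv _ e.toEquiv
  exact not_finite (ResidueField R)

end Avoidance

section Superficial

variable {R M : Type*} [CommRing R] [AddCommGroup M] [Module R M] (m : Ideal R)

/-- The Rees algebra of an ideal, as a ring. -/
def ReesRing : Type _ := reesAlgebra m

noncomputable instance : CommRing (ReesRing m) := inferInstanceAs (CommRing (reesAlgebra m))

instance [IsNoetherianRing R] : IsNoetherianRing (ReesRing m) :=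
  inferInstanceAs (IsNoetherianRing (reesAlgebra m))

/-- The inclusion of the Rees algebra in the polynomial ring. -/
noncomputable def ReesRing.toPolynomial : ReesRing m →+* R[X] := (reesAlgebra m).val.toRingHom

theorem ReesRing.toPolynomial_injective : Function.Injective (ReesRing.toPolynomial m) :=
  Subtype.val_injective

theorem ReesRing.coeff_mem (r : ReesRing m) (i : ℕ) :
    (ReesRing.toPolynomial m r).coeff i ∈ m ^ i := r.2 i

noncomputable instance : Module (ReesRing m) (PolynomialModule R M) :=
  Module.compHom _ (ReesRing.toPolynomial m)

/-- A homogeneous element of the Rees algebra. -/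
noncomputable def reesMonomial (n : ℕ) (a : R) (ha : a ∈ m ^ n) : ReesRing m :=
  (⟨Polynomial.monomial n a, reesAlgebra.monomial_mem.mpr ha⟩ : reesAlgebra m)

theorem toPolynomial_reesMonomial (n : ℕ) (a : R) (ha : a ∈ m ^ n) :
    ReesRing.toPolynomial m (reesMonomial m n a ha) = Polynomial.monomial n a := rfl

/-- The inclusion of `m` in the Rees algebra as its component of degree one. -/
noncomputable def reesDegreeOne (a : m) : ReesRing m :=
  reesMonomial m 1 a (by simp)

theorem toPolynomial_reesDegreeOne (a : m) :
    ReesRing.toPolynomial m (reesDegreeOne m a) = Polynomial.monomial 1 (a : R) := rfl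

theorem reesDegreeOne_add (a b : m) :
    reesDegreeOne m (a + b) = reesDegreeOne m a + reesDegreeOne m b := by
  apply ReesRing.toPolynomial_injective
  rw [map_add]
  simp only [toPolynomial_reesDegreeOne, Submodule.coe_add, map_add]

theorem reesDegreeOne_smul (r : R) (a : m) :
    reesDegreeOne m (r • a) = reesMonomial m 0 r (by simp) * reesDegreeOne m a := by
  apply ReesRing.toPolynomial_injective
  rw [map_mul, toPolynomial_reesDegreeOne, toPolynomial_reesDegreeOne, toPolynomial_reesMonomial,
    Polynomial.monomial_mul_monomial, zero_add]
  rfl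

/-- An element of `m^(N+n)` is a sum of products of `N` factors from `m` with an element of `m^n`.
Consequently monomials of degree at least `N` kill whatever the `N`-th power of the degree one ideal
kills. -/
theorem reesMonomial_mem_pow (N n : ℕ) (a : R) (ha : a ∈ m ^ (N + n)) :
    reesMonomial m (N + n) a ha ∈ (Ideal.span (Set.range (reesDegreeOne m))) ^ N := by
  induction N generalizing n a with
  | zero => simp
  | succ N ih =>
    have hpow : m * m ^ (N + n) = m ^ (N + 1 + n) := by
      rw [← pow_succ']; congr 1; ring
    have key : ∀ b ∈ m * m ^ (N + n), ∃ h : b ∈ m ^ (N + 1 + n),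
        reesMonomial m (N + 1 + n) b h ∈ (Ideal.span (Set.range (reesDegreeOne m))) ^ (N + 1) := by
      intro b hb
      refine Submodule.mul_induction_on hb ?_ ?_
      · intro c hc d hd
        refine ⟨hpow ▸ Ideal.mul_mem_mul hc hd, ?_⟩
        have : reesMonomial m (N + 1 + n) (c * d) (hpow ▸ Ideal.mul_mem_mul hc hd) =
            reesDegreeOne m ⟨c, hc⟩ * reesMonomial m (N + n) d hd := by
          apply ReesRing.toPolynomial_injective
          rw [map_mul, toPolynomial_reesDegreeOne, toPolynomial_reesMonomial,
            toPolynomial_reesMonomial, Polynomial.monomial_mul_monomial,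
            show 1 + (N + n) = N + 1 + n by ring]
        rw [this, pow_succ']
        exact Ideal.mul_mem_mul (Ideal.subset_span ⟨_, rfl⟩) (ih n d hd)
      · rintro x y ⟨hx', hx⟩ ⟨hy', hy⟩
        refine ⟨Ideal.add_mem _ hx' hy', ?_⟩
        have : reesMonomial m (N + 1 + n) (x + y) (Ideal.add_mem _ hx' hy') =
            reesMonomial m _ x hx' + reesMonomial m _ y hy' := by
          apply ReesRing.toPolynomial_injective
          simp only [map_add, toPolynomial_reesMonomial]
        rw [this]
        exact Ideal.add_mem _ hx hy
    exact (key a (by rwa [hpow])).2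

theorem ReesRing.eq_sum (r : ReesRing m) :
    r = ∑ i ∈ (ReesRing.toPolynomial m r).support,
      reesMonomial m i ((ReesRing.toPolynomial m r).coeff i) (ReesRing.coeff_mem m r i) := by
  apply ReesRing.toPolynomial_injective
  rw [map_sum]
  exact (ReesRing.toPolynomial m r).as_sum_support

variable {m} in
/-- The submodule over the Rees algebra attached to a filtration. -/
noncomputable def Ideal.Filtration.reesSubmodule (F : m.Filtration M) :
    Submodule (ReesRing m) (PolynomialModule R M) where
  carrier := {f | ∀ i, f.coeff i ∈ F.N i}
  add_mem' hf hg i := Submodule.add_mem _ (hf i) (hg i)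
  zero_mem' _ := Submodule.zero_mem _
  smul_mem' r f hf := F.submodule.smul_mem (r : reesAlgebra m) (x := f) hf

variable {m} in
theorem Ideal.Filtration.reesSubmodule_fg (F : m.Filtration M) (hF : F.submodule.FG) :
    F.reesSubmodule.FG := by
  obtain ⟨T, hT⟩ := hF
  refine ⟨T, le_antisymm (Submodule.span_le.mpr fun x hx => ?_) fun x hx => ?_⟩
  · have : x ∈ F.submodule := hT ▸ Submodule.subset_span hx
    exact this
  · have hx' : x ∈ F.submodule := hx
    rw [← hT] at hx'
    induction hx' using Submodule.span_induction with
    | mem y hy => exact Submodule.subset_span hy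
    | zero => exact Submodule.zero_mem _
    | add y z hy hz h1 h2 =>
      exact Submodule.add_mem _ (h1 (by have : y ∈ F.submodule := hT ▸ hy
                                        exact this))
        (h2 (by have : z ∈ F.submodule := hT ▸ hz
                exact this))
    | smul r y hy h1 =>
      exact Submodule.smul_mem _ (show ReesRing m from r)
        (h1 (by have : y ∈ F.submodule := hT ▸ hy
                exact this))

variable (M)

/-- The associated graded module `⨁ mⁿM/mⁿ⁺¹M` over the Rees algebra. -/
abbrev ReesGraded : Type _ :=
  (m.stableFiltration (⊤ : Submodule R M)).reesSubmodule ⧸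
    ((m.stableFiltration (m • (⊤ : Submodule R M))).reesSubmodule).submoduleOf
      (m.stableFiltration (⊤ : Submodule R M)).reesSubmodule

variable {M}

/-- The class of a single element in the associated graded module. -/
noncomputable def ReesGraded.mk
    (f : (m.stableFiltration (⊤ : Submodule R M)).reesSubmodule) : ReesGraded M m :=
  Submodule.Quotient.mk f

theorem ReesGraded.mk_eq_mk_iff
    (f g : (m.stableFiltration (⊤ : Submodule R M)).reesSubmodule) :
    ReesGraded.mk m f = ReesGraded.mk m g ↔
      ∀ i, (f : PolynomialModule R M).coeff i - (g : PolynomialModule R M).coeff i ∈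
        m ^ i • m • (⊤ : Submodule R M) := by
  refine (Submodule.Quotient.eq _).trans ?_
  rfl

/-- The `m`-adic filtration is stable, so its Rees module is finitely generated; the associated
graded module is a quotient of it. -/
theorem ReesGraded.finite [IsNoetherianRing R] [Module.Finite R M] :
    Module.Finite (ReesRing m) (ReesGraded M m) := by
  have : Module.Finite (ReesRing m) (m.stableFiltration (⊤ : Submodule R M)).reesSubmodule := by
    refine Module.Finite.iff_fg.mpr (Ideal.Filtration.reesSubmodule_fg _ ?_)
    exact ((m.stableFiltration (⊤ : Submodule R M)).submodule_fg_iff_stable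
      fun i => IsNoetherian.noetherian _).mpr (m.stableFiltration_stable ⊤)
  infer_instance

/-- An element of degree one that avoids the relevant associated primes of the associated graded
module acts injectively on it in large degrees. -/
theorem exists_mem_of_smul_mem [IsNoetherianRing R] [Module.Finite R M] (x : m)
    (hx : ∀ P ∈ associatedPrimes (ReesRing m) (ReesGraded M m), reesDegreeOne m x ∈ P →
      ∀ y, reesDegreeOne m y ∈ P) :
    ∃ D, ∀ n ≥ D, ∀ u ∈ m ^ n • (⊤ : Submodule R M),
      (x : R) • u ∈ m ^ (n + 2) • (⊤ : Submodule R M) →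
      u ∈ m ^ (n + 1) • (⊤ : Submodule R M) := by
  classical
  have hfin := ReesGraded.finite (M := M) m
  set K := Submodule.torsionBy (ReesRing m) (ReesGraded M m) (reesDegreeOne m x) with hK
  have hKN : IsNoetherian (ReesRing m) (ReesGraded M m) := isNoetherian_of_isNoetherianRing_of_finite _ _
  have hKf : Module.Finite (ReesRing m) K := inferInstance
  -- Minimal primes over the annihilator of `K` are associated to `K`, hence to the graded module.
  -- They contain the form of `x`, so by hypothesis all of degree one; thus a power of the degree
  -- one ideal kills `K`.
  have hle : Ideal.span (Set.range (reesDegreeOne m)) ≤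
      (Module.annihilator (ReesRing m) K).radical := by
    rw [← Ideal.sInf_minimalPrimes, le_sInf_iff]
    intro P hP
    rw [Ideal.span_le]
    have hPK : P ∈ associatedPrimes (ReesRing m) K :=
      Module.associatedPrimes.minimalPrimes_annihilator_subset_associatedPrimes _ _ hP
    have hPQ := associatedPrimes.subset_of_injective K.injective_subtype hPK
    rintro _ ⟨y, rfl⟩
    refine hx P hPQ ?_ y
    apply hP.1.2
    rw [Module.mem_annihilator]
    exact fun k => Subtype.ext ((Submodule.mem_torsionBy_iff _ _).mp k.2)
  obtain ⟨N, hN⟩ := Ideal.exists_radical_pow_le_of_fg (Module.annihilator (ReesRing m) K)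
    (IsNoetherian.noetherian _)
  have hJ : Ideal.span (Set.range (reesDegreeOne m)) ^ N ≤ Module.annihilator (ReesRing m) K :=
    (Ideal.pow_right_mono hle N).trans hN
  -- elements of `K` with a representative of degree less than `D`
  let B : ℕ → ReesGraded M m → Prop := fun D q =>
    ∃ f : (m.stableFiltration (⊤ : Submodule R M)).reesSubmodule, ReesGraded.mk m f = q ∧
      ∀ i ≥ D, (f : PolynomialModule R M).coeff i = 0
  have hB0 : ∀ D, B D 0 := fun D => ⟨0, rfl, fun i _ => rfl⟩
  have hBadd : ∀ D q q', B D q → B D q' → B D (q + q') := by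
    rintro D _ _ ⟨f, rfl, hf⟩ ⟨g, rfl, hg⟩
    refine ⟨f + g, rfl, fun i hi => ?_⟩
    change (f : PolynomialModule R M).coeff i + (g : PolynomialModule R M).coeff i = 0
    rw [hf i hi, hg i hi, add_zero]
  have hBmono : ∀ D D' q, D ≤ D' → B D q → B D' q := by
    rintro D D' _ h ⟨f, rfl, hf⟩
    exact ⟨f, rfl, fun i hi => hf i (h.trans hi)⟩
  have hBex : ∀ q, ∃ c, B c q := by
    intro q
    obtain ⟨f, rfl⟩ := Submodule.Quotient.mk_surjective _ q
    refine ⟨(f : PolynomialModule R M).coeff.support.sup id + 1, f, rfl, fun i hi => ?_⟩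
    by_contra h
    have : i ≤ (f : PolynomialModule R M).coeff.support.sup id :=
      Finset.le_sup (f := id) (Finsupp.mem_support_iff.mpr h)
    omega
  -- A monomial of degree below `N` raises the degree bound by less than `N`, and one of degree at
  -- least `N` kills `q`. With finitely many generators, `K` is therefore bounded in degree.
  have hBsmul : ∀ c, ∀ q ∈ K, B c q → ∀ r : ReesRing m, B (c + N) (r • q) := by
    intro c q hq hcq r
    rw [ReesRing.eq_sum m r, Finset.sum_smul]
    refine Finset.sum_induction _ (B (c + N)) (hBadd _) (hB0 _) fun i _ => ?_
    rcases lt_or_ge i N with hi | hi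
    · obtain ⟨f, rfl, hf⟩ := hcq
      refine ⟨reesMonomial m i ((ReesRing.toPolynomial m r).coeff i) (ReesRing.coeff_mem m r i) • f, rfl, fun j hj => ?_⟩
      change (Polynomial.monomial i ((ReesRing.toPolynomial m r).coeff i) • (f : PolynomialModule R M)).coeff j = 0
      rw [PolynomialModule.monomial_smul_apply, if_pos (by omega), hf _ (by omega), smul_zero]
    · obtain ⟨j, rfl⟩ := Nat.exists_eq_add_of_le hi
      have h1 := hJ (reesMonomial_mem_pow m N j _ (ReesRing.coeff_mem m r (N + j)))
      have h2 := congrArg Subtype.val ((Module.mem_annihilator.mp h1) ⟨q, hq⟩)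
      have h3 : reesMonomial m (N + j) ((ReesRing.toPolynomial m r).coeff (N + j)) (ReesRing.coeff_mem m r (N + j)) • q = 0 := h2
      rw [h3]
      exact hB0 _
  have hBall : ∃ D, ∀ q ∈ K, B D q := by
    obtain ⟨T, hT⟩ : K.FG := IsNoetherian.noetherian _
    choose c hc using hBex
    refine ⟨T.sup c + N, fun q hq => ?_⟩
    have hall : ∀ r : ReesRing m, B (T.sup c + N) (r • q) := by
      rw [← hT] at hq
      induction hq using Submodule.span_induction with
      | mem y hy =>
        refine hBsmul _ y (hT ▸ Submodule.subset_span hy) (hBmono _ _ _ ?_ (hc y))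
        exact Finset.le_sup hy
      | zero => intro r; rw [smul_zero]; exact hB0 _
      | add y z _ _ hy hz => intro r; rw [smul_add]; exact hBadd _ _ _ (hy r) (hz r)
      | smul s y _ hy => intro r; rw [smul_smul]; exact hy _
    simpa using hall 1
  obtain ⟨D, hD⟩ := hBall
  refine ⟨D, fun n hn u hu hxu => ?_⟩
  have hmem : PolynomialModule.single R n u ∈
      (m.stableFiltration (⊤ : Submodule R M)).reesSubmodule := by
    intro i
    rw [PolynomialModule.coeff_single, Finsupp.single_apply]
    split_ifs with h
    · subst h; exact hu
    · exact Submodule.zero_mem _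
  -- The class of `u` in degree `n` is killed by the form of `x`. As `K` lives in degrees below `D ≤
  -- n`, this class is zero.
  have hk : ReesGraded.mk m ⟨_, hmem⟩ ∈ K := by
    rw [hK, Submodule.mem_torsionBy_iff]
    change ReesGraded.mk m (reesDegreeOne m x • ⟨_, hmem⟩) = ReesGraded.mk m 0
    rw [ReesGraded.mk_eq_mk_iff]
    intro i
    change (Polynomial.monomial 1 (x : R) • PolynomialModule.single R n u).coeff i - 0 ∈ _
    rw [PolynomialModule.monomial_smul_single, PolynomialModule.coeff_single, Finsupp.single_apply,
      sub_zero]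
    split_ifs with h
    · subst h
      rw [← mul_smul, ← pow_succ, show 1 + n + 1 = n + 2 by ring]
      exact hxu
    · exact Submodule.zero_mem _
  obtain ⟨g, hg, hg0⟩ := hD _ hk
  rw [ReesGraded.mk_eq_mk_iff] at hg
  have := hg n
  rw [hg0 n hn] at this
  change 0 - (Finsupp.single n u) n ∈ _ at this
  rw [Finsupp.single_eq_same, zero_sub, Submodule.neg_mem_iff, ← mul_smul, ← pow_succ] at this
  exact this

end Superficial

section SuperficialExistence

open IsLocalRing

/-- The elements of `m` whose degree one form lies in a given ideal of the Rees algebra. -/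
noncomputable def degreeOneSubmodule {R : Type*} [CommRing R] (m : Ideal R)
    (P : Ideal (ReesRing m)) : Submodule R m where
  carrier := {a | reesDegreeOne m a ∈ P}
  add_mem' {a b} ha hb := by
    change reesDegreeOne m (a + b) ∈ P
    rw [reesDegreeOne_add]
    exact P.add_mem ha hb
  zero_mem' := by
    change reesDegreeOne m 0 ∈ P
    have : reesDegreeOne m 0 = 0 := by
      apply ReesRing.toPolynomial_injective
      simp [toPolynomial_reesDegreeOne]
    rw [this]
    exact P.zero_mem
  smul_mem' r a ha := by
    change reesDegreeOne m (r • a) ∈ P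
    rw [reesDegreeOne_smul]
    exact P.mul_mem_left _ ha

variable {R M : Type*} [CommRing R] [IsNoetherianRing R]
  [AddCommGroup M] [Module R M] [Module.Finite R M]

/-- Colon ideals by an element with injective initial form and a regularity condition. -/
theorem exists_forall_mem_of_smul_mem (m : Ideal R) {x : R}
    (hreg : IsSMulRegular M x) {D : ℕ}
    (hD : ∀ n ≥ D, ∀ u ∈ m ^ n • (⊤ : Submodule R M),
      x • u ∈ m ^ (n + 2) • (⊤ : Submodule R M) → u ∈ m ^ (n + 1) • (⊤ : Submodule R M)) :
    ∃ n₀, ∀ n ≥ n₀, ∀ u : M, x • u ∈ m ^ (n + 1) • (⊤ : Submodule R M) →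
      u ∈ m ^ n • (⊤ : Submodule R M) := by
  -- Artin–Rees for `xM ⊆ M`; after cancelling the regular element `x` it places `u` in `m^(n+1-k)
  -- M`.
  obtain ⟨k, hk⟩ := m.exists_pow_inf_eq_pow_smul (LinearMap.range (LinearMap.lsmul R M x))
  refine ⟨D + k, fun n hn u hu => ?_⟩
  have h1 : u ∈ m ^ (n + 1 - k) • (⊤ : Submodule R M) := by
    have h2 : x • u ∈ m ^ (n + 1) • (⊤ : Submodule R M) ⊓
        LinearMap.range (LinearMap.lsmul R M x) := ⟨hu, u, rfl⟩
    rw [hk (n + 1) (by omega)] at h2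
    have h3 : x • u ∈ m ^ (n + 1 - k) • LinearMap.range (LinearMap.lsmul R M x) :=
      Submodule.smul_mono le_rfl inf_le_right h2
    rw [← Submodule.map_top, ← Submodule.map_smul''] at h3
    obtain ⟨w, hw, hwu⟩ := h3
    rwa [← hreg hwu]
  -- From there `hD` raises the power of `m` by one at a time; `n ≥ D + k` keeps the exponents in
  -- its range.
  have key : ∀ j, n + 1 - k + j ≤ n → u ∈ m ^ (n + 1 - k + j) • (⊤ : Submodule R M) := by
    intro j
    induction j with
    | zero => intro _; exact h1
    | succ j ih =>
      intro hj
      refine hD (n + 1 - k + j) (by omega) u (ih (by omega)) ?_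
      exact Submodule.smul_mono_left (Ideal.pow_le_pow_right (by omega)) hu
  rcases Nat.eq_zero_or_pos k with rfl | hk0
  · exact Submodule.smul_mono_left (Ideal.pow_le_pow_right (by omega)) h1
  · have := key (k - 1) (by omega)
    rwa [show n + 1 - k + (k - 1) = n by omega] at this

/-- Existence of a regular superficial element. -/
theorem exists_isSMulRegular_superficial [IsLocalRing R] [Infinite (ResidueField R)]
    (h : ∃ r ∈ maximalIdeal R, IsSMulRegular M r) :
    ∃ x ∈ maximalIdeal R, IsSMulRegular M x ∧ ∃ n₀, ∀ n ≥ n₀, ∀ u : M,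
      x • u ∈ maximalIdeal R ^ (n + 1) • (⊤ : Submodule R M) →
      u ∈ maximalIdeal R ^ n • (⊤ : Submodule R M) := by
  classical
  set m := maximalIdeal R
  have hfin := ReesGraded.finite (M := M) m
  have hA := associatedPrimes.finite R M
  have hB := associatedPrimes.finite (ReesRing m) (ReesGraded M m)
  -- To be avoided: the traces on `m` of the associated primes of `M`, for regularity, and the
  -- degree one parts of the associated primes of the graded module that do not contain all of
  -- degree one. The former are proper since `m` contains a regular element.
  let s : Finset (Submodule R m) := (hA.toFinset.image fun q => Submodule.comap m.subtype q) ∪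
    (hB.toFinset.image (degreeOneSubmodule m)).filter (· ≠ ⊤)
  obtain ⟨w, hw⟩ := exists_forall_notMem_of_infinite_residueField s (by
    intro V hV
    rcases Finset.mem_union.mp hV with hV | hV
    · obtain ⟨q, hq, rfl⟩ := Finset.mem_image.mp hV
      rw [Set.Finite.mem_toFinset] at hq
      intro htop
      obtain ⟨r, hr, hreg⟩ := h
      have hrq : r ∈ q := by
        have : (⟨r, hr⟩ : m) ∈ Submodule.comap m.subtype q := htop ▸ Submodule.mem_top
        exact this
      have : r ∈ ⋃ p ∈ associatedPrimes R M, (p : Set R) := Set.mem_biUnion hq hrq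
      rw [biUnion_associatedPrimes_eq_compl_regular] at this
      exact this hreg
    · exact (Finset.mem_filter.mp hV).2)
  have hreg : IsSMulRegular M (w : R) := by
    by_contra hcon
    have : (w : R) ∈ ⋃ p ∈ associatedPrimes R M, (p : Set R) := by
      rw [biUnion_associatedPrimes_eq_compl_regular]
      exact hcon
    obtain ⟨q, hq, hwq⟩ := Set.mem_iUnion₂.mp this
    refine hw (Submodule.comap m.subtype q) (Finset.mem_union_left _ ?_) hwq
    exact Finset.mem_image_of_mem _ (hA.mem_toFinset.mpr hq)
  obtain ⟨D, hD⟩ := exists_mem_of_smul_mem (M := M) m w (by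
    intro P hP hwP y
    by_contra hy
    refine hw (degreeOneSubmodule m P) (Finset.mem_union_right _ ?_) hwP
    refine Finset.mem_filter.mpr ⟨Finset.mem_image_of_mem _ (hB.mem_toFinset.mpr hP), fun htop => ?_⟩
    exact hy (show y ∈ degreeOneSubmodule m P from htop ▸ Submodule.mem_top))
  exact ⟨w, w.2, hreg, exists_forall_mem_of_smul_mem m hreg hD⟩

end SuperficialExistence

/-! ### Difference operators on polynomials and Hilbert–Samuel lengths -/

section PolynomialDifference

open Polynomial

/-- Taylor expansion at `-1`. The factor `D + 1` is what turns `D!` into `(D + 1)!`, so the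
normalized coefficient is unchanged on passing to the quotient by a superficial element. -/
theorem Polynomial.coeff_sub_comp_X_sub_one {P : ℚ[X]} {D : ℕ} (hP : P.natDegree ≤ D + 1) :
    (P - P.comp (X - 1)).coeff D = (D + 1) * P.coeff (D + 1) := by
  have h1 : P.comp (X - 1) = taylor (-1) P := by
    rw [taylor_apply]; simp [sub_eq_add_neg]
  have h2 : (hasseDeriv D P).natDegree < 2 :=
    lt_of_le_of_lt (natDegree_hasseDeriv_le P D) (by omega)
  rw [coeff_sub, h1, taylor_coeff, eval_eq_sum_range' h2]
  simp [Finset.sum_range_succ, hasseDeriv_coeff, add_comm 1 D]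

theorem Polynomial.natDegree_le_of_sub_comp {P : ℚ[X]} {d : ℕ}
    (h : (P - P.comp (X - 1)).natDegree ≤ d) : P.natDegree ≤ d + 1 := by
  by_contra! hcon
  obtain ⟨D, hD⟩ : ∃ D, P.natDegree = D + 1 := ⟨P.natDegree - 1, by omega⟩
  have h1 := Polynomial.coeff_sub_comp_X_sub_one hD.le
  rw [Polynomial.coeff_eq_zero_of_natDegree_lt (by omega)] at h1
  have h2 : P.coeff (D + 1) ≠ 0 := by
    rw [← hD]
    exact leadingCoeff_ne_zero.mpr (by rintro rfl; simp at hD)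
  have h3 : (D + 1 : ℚ) ≠ 0 := by positivity
  exact mul_ne_zero h3 h2 h1.symm

theorem Polynomial.eq_of_eventually_eval_eq {P Q : ℚ[X]}
    (h : ∀ᶠ n : ℕ in atTop, P.eval (n : ℚ) = Q.eval (n : ℚ)) : P = Q := by
  obtain ⟨N, hN⟩ := eventually_atTop.mp h
  refine Polynomial.eq_of_infinite_eval_eq P Q ?_
  refine Set.Infinite.mono (s := (fun n : ℕ => (n : ℚ)) '' Set.Ici N) ?_ ?_
  · rintro _ ⟨n, hn, rfl⟩
    exact hN n hn
  · exact (Set.Ici_infinite N).image Nat.cast_injective.injOn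

end PolynomialDifference

section Length

open IsLocalRing
open scoped Pointwise

variable {R M : Type*} [CommRing R] [AddCommGroup M] [Module R M]

theorem length_quotient_smul_ne_top (m : Ideal R) [m.IsMaximal] [Module.Finite R M] :
    Module.length R (M ⧸ m • (⊤ : Submodule R M)) ≠ ⊤ := by
  let _ := Ideal.Quotient.field (m)
  have hf : Module.Finite (R ⧸ m) (M ⧸ m • (⊤ : Submodule R M)) :=
    Module.Finite.of_restrictScalars_finite R _ _
  rw [Module.length_eq_of_surjective (R := R ⧸ m) Ideal.Quotient.mk_surjective,
    Module.length_eq_finrank]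
  exact ENat.natCast_ne_top _

/-- Each layer `m^n M / m^(n+1) M` is a finite-dimensional space over `R/m`. -/
theorem length_quotient_pow_smul_ne_top [IsNoetherianRing R] [Module.Finite R M] (m : Ideal R)
    [m.IsMaximal] (n : ℕ) :
    Module.length R (M ⧸ m ^ n • (⊤ : Submodule R M)) ≠ ⊤ := by
  induction n with
  | zero =>
    have : Subsingleton (M ⧸ m ^ 0 • (⊤ : Submodule R M)) := by
      rw [pow_zero, Submodule.one_smul]
      exact Submodule.Quotient.subsingleton_iff.mpr rfl
    rw [Module.length_eq_zero]
    exact ENat.zero_ne_top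
  | succ n ih =>
    have hle : m ^ (n + 1) • (⊤ : Submodule R M) ≤ m ^ n • ⊤ :=
      Submodule.smul_mono_left (Ideal.pow_le_pow_right (Nat.le_succ n))
    let W : Submodule R M := m ^ n • ⊤
    let f : W →ₗ[R] M ⧸ m ^ (n + 1) • (⊤ : Submodule R M) := (Submodule.mkQ _).comp W.subtype
    have hfker : m • (⊤ : Submodule R W) ≤ LinearMap.ker f := by
      rw [Submodule.smul_le]
      rintro a ha w -
      rw [LinearMap.mem_ker]
      refine (Submodule.Quotient.mk_eq_zero _).mpr ?_
      rw [pow_succ', mul_smul]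
      exact Submodule.smul_mem_smul ha w.2
    have hexact : Function.Exact (Submodule.liftQ _ f hfker) (Submodule.factor hle) := by
      intro y
      obtain ⟨z, rfl⟩ := Submodule.Quotient.mk_surjective _ y
      constructor
      · intro h
        have hz : z ∈ W := (Submodule.Quotient.mk_eq_zero _).mp h
        exact ⟨Submodule.Quotient.mk ⟨z, hz⟩, rfl⟩
      · rintro ⟨w, hw⟩
        obtain ⟨w, rfl⟩ := Submodule.Quotient.mk_surjective _ w
        rw [← hw]
        exact (Submodule.Quotient.mk_eq_zero _).mpr w.2
    have hR := Module.length_eq_add_of_exact (LinearMap.range (Submodule.liftQ _ f hfker)).subtype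
      (Submodule.factor hle) Subtype.val_injective (Submodule.factor_surjective hle)
      (by intro y; rw [hexact y]; simp)
    rw [hR]
    refine WithTop.add_ne_top.mpr ⟨?_, ih⟩
    refine ne_top_of_le_ne_top (length_quotient_smul_ne_top (M := W) m) ?_
    exact Module.length_le_of_surjective (Submodule.liftQ _ f hfker).rangeRestrict
      (LinearMap.surjective_rangeRestrict _)

/-- Multiplication by `x` gives `0 → M/m^n M → M/m^(n+1) M → M'/m^(n+1) M' → 0` with `M' = M/xM`;
the colon hypothesis is exactly injectivity on the left. -/
theorem length_quotient_pow_eq_add (m : Ideal R) {x : R} (hx : x ∈ m) {n : ℕ}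
    (hcol : ∀ u : M, x • u ∈ m ^ (n + 1) • (⊤ : Submodule R M) →
      u ∈ m ^ n • (⊤ : Submodule R M)) :
    Module.length R (M ⧸ m ^ (n + 1) • (⊤ : Submodule R M)) =
      Module.length R (M ⧸ m ^ n • (⊤ : Submodule R M)) +
      Module.length R (QuotSMulTop x M ⧸ m ^ (n + 1) • (⊤ : Submodule R (QuotSMulTop x M))) := by
  have hmap : (m ^ (n + 1) • (⊤ : Submodule R M)).map (Submodule.mkQ (x • (⊤ : Submodule R M))) =
      m ^ (n + 1) • (⊤ : Submodule R (QuotSMulTop x M)) := by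
    rw [Submodule.map_smul'', Submodule.map_top, Submodule.range_mkQ]
  have h1 : m ^ n • (⊤ : Submodule R M) ≤
      (m ^ (n + 1) • (⊤ : Submodule R M)).comap (LinearMap.lsmul R M x) := by
    intro u hu
    change x • u ∈ m ^ (n + 1) • (⊤ : Submodule R M)
    rw [pow_succ', mul_smul]
    exact Submodule.smul_mem_smul hx hu
  have h2 : m ^ (n + 1) • (⊤ : Submodule R M) ≤
      (m ^ (n + 1) • (⊤ : Submodule R (QuotSMulTop x M))).comap (Submodule.mkQ _) := by
    rw [← Submodule.map_le_iff_le_comap, hmap]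
  refine Module.length_eq_add_of_exact (Submodule.mapQ _ _ (LinearMap.lsmul R M x) h1)
    (Submodule.mapQ _ _ (Submodule.mkQ _) h2) ?_ ?_ ?_
  · refine (injective_iff_map_eq_zero _).mpr fun y hy => ?_
    obtain ⟨u, rfl⟩ := Submodule.Quotient.mk_surjective _ y
    exact (Submodule.Quotient.mk_eq_zero _).mpr
      (hcol u ((Submodule.Quotient.mk_eq_zero _).mp hy))
  · intro y
    obtain ⟨z, rfl⟩ := Submodule.Quotient.mk_surjective _ y
    obtain ⟨u, rfl⟩ := Submodule.Quotient.mk_surjective _ z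
    exact ⟨Submodule.Quotient.mk u, rfl⟩
  · intro y
    obtain ⟨u, rfl⟩ := Submodule.Quotient.mk_surjective _ y
    constructor
    · intro h
      have h' : Submodule.mkQ (x • (⊤ : Submodule R M)) u ∈
        m ^ (n + 1) • (⊤ : Submodule R (QuotSMulTop x M)) := (Submodule.Quotient.mk_eq_zero _).mp h
      rw [← hmap] at h'
      obtain ⟨v, hv, hvu⟩ := h'
      have h3 : u - v ∈ x • (⊤ : Submodule R M) :=
        (Submodule.Quotient.eq _).mp (show Submodule.Quotient.mk u = Submodule.Quotient.mk v from hvu.symm)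
      obtain ⟨w, -, hw⟩ := (Submodule.mem_smul_pointwise_iff_exists _ _ _).mp h3
      refine ⟨Submodule.Quotient.mk w, ?_⟩
      refine (Submodule.Quotient.eq _).mpr ?_
      change x • w - u ∈ m ^ (n + 1) • (⊤ : Submodule R M)
      rw [hw]
      simpa using hv
    · rintro ⟨w, hw⟩
      obtain ⟨w, rfl⟩ := Submodule.Quotient.mk_surjective _ w
      rw [← hw]
      refine (Submodule.Quotient.mk_eq_zero _).mpr ?_
      have : Submodule.mkQ (x • (⊤ : Submodule R M)) (x • w) = 0 :=
        (Submodule.Quotient.mk_eq_zero _).mpr (Submodule.smul_mem_pointwise_smul _ _ _ trivial)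
      change Submodule.mkQ (x • (⊤ : Submodule R M)) (x • w) ∈ _
      rw [this]
      exact Submodule.zero_mem _

/-- A nonzero such module is supported only at the maximal ideal, which is then the radical of its
annihilator. -/
theorem exists_pow_smul_eq_bot_of_supportDim_le_zero [IsLocalRing R] [IsNoetherianRing R]
    [Module.Finite R M]
    (h : Module.supportDim R M ≤ 0) :
    ∃ N, maximalIdeal R ^ N • (⊤ : Submodule R M) = ⊥ := by
  by_cases hM : Subsingleton M
  · exact ⟨0, Subsingleton.elim _ _⟩
  rw [not_subsingleton_iff_nontrivial] at hM
  have h0 : Module.supportDim R M = 0 := by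
    refine le_antisymm h ?_
    rw [Module.supportDim, Order.krullDim_nonneg_iff]
    exact (Module.nonempty_support_iff).mpr hM |>.to_subtype
  have hs := support_of_supportDim_eq_zero R M h0
  rw [Module.support_eq_zeroLocus] at hs
  have hrad : (Module.annihilator R M).radical = maximalIdeal R := by
    rw [← PrimeSpectrum.vanishingIdeal_zeroLocus_eq_radical, hs]
    rw [PrimeSpectrum.vanishingIdeal_zeroLocus_eq_radical]
    exact (Ideal.IsMaximal.isPrime' (maximalIdeal R)).radical
  obtain ⟨N, hN⟩ := Ideal.exists_radical_pow_le_of_fg (Module.annihilator R M)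
    (IsNoetherian.noetherian _)
  rw [hrad] at hN
  refine ⟨N, ?_⟩
  rw [eq_bot_iff, Submodule.smul_le]
  intro r hr x _
  exact (Submodule.mem_bot R).mpr (Module.mem_annihilator.mp (hN hr) x)

end Length

/-! ### Multiplicity as the length modulo a superficial regular sequence -/

section Multiplicity

open IsLocalRing Polynomial
open scoped Pointwise Nat

variable {R : Type u} [CommRing R] [IsLocalRing R] [IsNoetherianRing R]

/-- Vanishing of `Hom(R/m, M)` means that `m` is not associated to `M`; prime avoidance then gives a
regular element in `m`. -/
theorem exists_isSMulRegular_of_subsingleton_ext {M : Type u} [AddCommGroup M] [Module R M]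
    [Module.Finite R M] (h : Subsingleton (ExtMod R (R ⧸ maximalIdeal R) M 0)) :
    ∃ r ∈ maximalIdeal R, IsSMulRegular M r := by
  have h' : Subsingleton ((R ⧸ maximalIdeal R) →ₗ[R] M) :=
    (ExtMod.zeroEquiv R _ M).symm.injective.subsingleton
  obtain ⟨r, hr, hreg⟩ := IsSMulRegular.subsingleton_linearMap_iff.mp h'
  rw [Ideal.annihilator_quotient] at hr
  exact ⟨r, hr, hreg⟩

theorem supportDim_quotSMulTop_le {M : Type*} [AddCommGroup M] [Module R M] [Module.Finite R M]
    {x : R} (hx : IsSMulRegular M x) (hxm : x ∈ maximalIdeal R) {d : ℕ}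
    (hd : Module.supportDim R M ≤ (d + 1 : ℕ)) :
    Module.supportDim R (QuotSMulTop x M) ≤ d := by
  have h := Module.supportDim_quotSMulTop_succ_eq_supportDim hx hxm
  rw [← h] at hd
  push_cast at hd
  exact (ENat.WithBot.add_le_add_one_right_iff).mp hd

/-- A module with `depth ≥ d ≥ dim` over a local ring with infinite residue field has a regular
sequence of length `d` whose quotient has the multiplicity of the module as its length. -/
theorem exists_isWeaklyRegular_length_eq [Infinite (ResidueField R)] (d : ℕ) :
    ∀ (M : Type u) [AddCommGroup M] [Module R M] [Module.Finite R M],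
    (∀ i < d, Subsingleton (ExtMod R (R ⧸ maximalIdeal R) M i)) → Module.supportDim R M ≤ d →
    ∀ P : ℚ[X], (∀ᶠ n : ℕ in atTop, P.eval (n : ℚ) =
      ((Module.length R (M ⧸ maximalIdeal R ^ (n + 1) • (⊤ : Submodule R M))).toNat : ℚ)) →
    P.natDegree ≤ d ∧ ∃ rs : List R, (∀ x ∈ rs, x ∈ maximalIdeal R) ∧
      RingTheory.Sequence.IsWeaklyRegular M rs ∧ rs.length = d ∧
      Module.length R (M ⧸ Ideal.ofList rs • (⊤ : Submodule R M)) ≠ ⊤ ∧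
      (d ! : ℚ) * P.coeff d =
        ((Module.length R (M ⧸ Ideal.ofList rs • (⊤ : Submodule R M))).toNat : ℚ) := by
  induction d with
  | zero =>
    intro M _ _ _ _ hdim P hP
    obtain ⟨N, hN⟩ := exists_pow_smul_eq_bot_of_supportDim_le_zero (M := M) (by simpa using hdim)
    have hNn : ∀ n, N ≤ n → maximalIdeal R ^ n • (⊤ : Submodule R M) = ⊥ := fun n hn => by
      rw [eq_bot_iff, ← hN]
      exact Submodule.smul_mono_left (Ideal.pow_le_pow_right hn)
    have hl : ∀ n, N ≤ n → Module.length R (M ⧸ maximalIdeal R ^ n • (⊤ : Submodule R M)) =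
        Module.length R M := fun n hn =>
      (Submodule.quotEquivOfEqBot _ (hNn n hn)).length_eq
    have hPC : P = C ((Module.length R M).toNat : ℚ) := by
      refine Polynomial.eq_of_eventually_eval_eq ?_
      filter_upwards [hP, eventually_ge_atTop N] with n hn hnN
      rw [hn, hl _ (by omega), eval_C]
    have he : Module.length R (M ⧸ Ideal.ofList ([] : List R) • (⊤ : Submodule R M)) =
        Module.length R M :=
      (Submodule.quotEquivOfEqBot _ (by simp)).length_eq
    refine ⟨by rw [hPC, natDegree_C], [], by simp, RingTheory.Sequence.IsWeaklyRegular.nil R M, rfl,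
      ?_, ?_⟩
    · rw [he, ← hl N le_rfl]
      exact length_quotient_pow_smul_ne_top _ N
    · rw [he, hPC]
      simp
  | succ d ih =>
    intro M _ _ _ hext hdim P hP
    -- Modulo a regular superficial element, both the vanishing range of `Ext` and the dimension
    -- bound drop by one, and the Hilbert–Samuel polynomial becomes `P(n) - P(n - 1)`.
    obtain ⟨x, hxm, hx, n₀, hcol⟩ := exists_isSMulRegular_superficial
      (exists_isSMulRegular_of_subsingleton_ext (hext 0 (by omega)))
    have hk : ∀ y : R ⧸ maximalIdeal R, x • y = 0 := fun y => by
      obtain ⟨z, rfl⟩ := Ideal.Quotient.mk_surjective y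
      exact Ideal.Quotient.eq_zero_iff_mem.mpr (Ideal.mul_mem_right _ _ hxm)
    obtain ⟨h1, rs, hrs, hreg, hlen, hfin, hcoeff⟩ := ih (QuotSMulTop x M)
      (fun i hi => ExtMod.subsingleton_quotSMulTop hx hk i (hext i (by omega))
        (hext (i + 1) (by omega)))
      (supportDim_quotSMulTop_le hx hxm hdim) (P - P.comp (X - 1)) (by
        obtain ⟨N, hN⟩ := eventually_atTop.mp hP
        filter_upwards [eventually_ge_atTop (n₀ + N + 1)] with n hn
        have hadd := length_quotient_pow_eq_add (M := M) (maximalIdeal R) hxm (hcol n (by omega))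
        obtain ⟨j, rfl⟩ : ∃ j, n = j + 1 := ⟨n - 1, by omega⟩
        have hA := length_quotient_pow_smul_ne_top (M := M) (maximalIdeal R) (j + 1)
        have hB := length_quotient_pow_smul_ne_top (M := QuotSMulTop x M) (maximalIdeal R) (j + 1 + 1)
        have hnat := congrArg ENat.toNat hadd
        rw [ENat.toNat_add hA hB] at hnat
        rw [eval_sub, eval_comp, hN _ (by omega), hnat]
        have hj := hN j (by omega)
        simp only [eval_sub, eval_X, eval_one]
        rw [show ((j + 1 : ℕ) : ℚ) - 1 = j by push_cast; ring, hj]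
        push_cast
        ring)
    have hdeg := Polynomial.natDegree_le_of_sub_comp h1
    have he := (Submodule.quotOfListConsSMulTopEquivQuotSMulTopInner M x rs).length_eq
    refine ⟨hdeg, x :: rs, by simpa using ⟨hxm, hrs⟩,
      (RingTheory.Sequence.isWeaklyRegular_cons_iff M x rs).mpr ⟨hx, hreg⟩, by simp [hlen], ?_, ?_⟩
    · rw [he]
      exact hfin
    · rw [he, ← hcoeff, Polynomial.coeff_sub_comp_X_sub_one hdeg, Nat.factorial_succ]
      push_cast
      ring

end Multiplicity

/-! ### Reduction to an infinite residue field -/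

section Extension

open IsLocalRing Polynomial

/-- A Noetherian local ring has a flat local extension with infinite residue field whose maximal
ideal is extended: the localization of `R[X]` at the prime ideal generated by `m`. -/
theorem IsLocalRing.exists_flat_extension (R : Type u) [CommRing R] [IsLocalRing R]
    [IsNoetherianRing R] :
    ∃ (S : Type u) (_ : CommRing S) (_ : IsLocalRing S) (_ : IsNoetherianRing S) (_ : Algebra R S),
      Module.Flat R S ∧ (maximalIdeal R).map (algebraMap R S) = maximalIdeal S ∧
      Infinite (ResidueField S) := by
  let p : Ideal R[X] := (maximalIdeal R).map C
  have hp : p.IsPrime := Ideal.isPrime_map_C_of_isPrime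
  let S := Localization.AtPrime p
  refine ⟨S, inferInstance, inferInstance, IsLocalization.isNoetherianRing p.primeCompl S inferInstance,
    inferInstance, ?_, ?_, ?_⟩
  · have : Module.Flat R[X] S := IsLocalization.flat S p.primeCompl
    exact Module.Flat.trans R R[X] S
  · rw [IsScalarTower.algebraMap_eq R R[X] S, ← Ideal.map_map]
    exact Localization.AtPrime.map_eq_maximalIdeal
  · refine Infinite.of_injective (fun n : ℕ => residue S (algebraMap R[X] S (X ^ n))) ?_
    intro a b hab
    by_contra hne
    have h1 : algebraMap R[X] S (X ^ a - X ^ b) ∈ maximalIdeal S := by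
      rw [← residue_eq_zero_iff, map_sub, map_sub]
      exact sub_eq_zero.mpr hab
    have h2 : X ^ a - X ^ b ∈ p :=
      (IsLocalization.AtPrime.to_map_mem_maximal_iff S p _).mp h1
    have h3 := Ideal.mem_map_C_iff.mp h2 a
    rw [coeff_sub, coeff_X_pow_self, coeff_X_pow, if_neg hne, sub_zero] at h3
    exact (Ideal.ne_top_iff_one _).mp (Ideal.IsMaximal.ne_top (maximalIdeal.isMaximal R)) h3

end Extension

/-! ### Cohen–Macaulay local rings and systems of parameters -/

section CohenMacaulay

open IsLocalRing

/-- A Cohen–Macaulay local ring has a regular sequence in its maximal ideal whose length is the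
Krull dimension. -/
theorem IsCohenMacaulayLocal.exists_isRegular {R : Type u} [CommRing R] [IsLocalRing R]
    (h : IsCohenMacaulayLocal R) :
    ∃ rs : List R, (∀ x ∈ rs, x ∈ maximalIdeal R) ∧ RingTheory.Sequence.IsRegular R rs ∧
      ringKrullDim R = rs.length := by
  have hN := h.1
  obtain ⟨d, hd⟩ : ∃ d : ℕ, ringKrullDim R = d := by
    have := ringKrullDim_lt_top (R := R)
    have h0 := ringKrullDim_nonneg_of_nontrivial (R := R)
    rw [← h.2] at this ⊢
    obtain ⟨d, hd⟩ := ENat.ne_top_iff_exists.mp (show localDepth R ≠ ⊤ by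
      rintro h; rw [h] at this; exact lt_irrefl _ this)
    exact ⟨d, by rw [← hd]; rfl⟩
  have h2 : localDepth R = (d : ℕ∞) := by
    have := h.2
    rw [hd] at this
    exact_mod_cast this
  rcases Nat.eq_zero_or_pos d with rfl | hpos
  · exact ⟨[], by simp, RingTheory.Sequence.IsRegular.nil R R, by simpa using hd⟩
  -- The supremum defining the depth is finite and so attained: some regular sequence is longer than
  -- `d - 1`, and none is longer than `d`.
  have hlt : ((d - 1 : ℕ) : ℕ∞) < localDepth R := by
    rw [h2]
    exact_mod_cast Nat.sub_lt hpos one_pos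
  obtain ⟨rs, hrs⟩ := lt_iSup_iff.mp hlt
  obtain ⟨hrs1, hrs2⟩ := lt_iSup_iff.mp hrs
  refine ⟨rs, hrs1.1, hrs1.2, ?_⟩
  have h3 : (rs.length : ℕ∞) ≤ localDepth R := by
    rw [localDepth]
    exact le_iSup₂_of_le rs hrs1 le_rfl
  rw [h2] at h3
  have h4 : rs.length ≤ d := by exact_mod_cast h3
  have h5 : d - 1 < rs.length := by exact_mod_cast hrs2
  rw [hd, show rs.length = d by omega]

/-- A power of the maximal ideal lies in the ideal generated by a maximal regular sequence. -/
theorem exists_pow_le_ofList {R : Type u} [CommRing R] [IsLocalRing R] [IsNoetherianRing R]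
    {rs : List R} (hrs : RingTheory.Sequence.IsRegular R rs)
    (hd : ringKrullDim R = rs.length) : ∃ N, maximalIdeal R ^ N ≤ Ideal.ofList rs := by
  have h := Module.supportDim_add_length_eq_supportDim_of_isRegular rs hrs
  rw [Module.supportDim_self_eq_ringKrullDim, hd] at h
  have h0 : Module.supportDim R (R ⧸ Ideal.ofList rs • (⊤ : Submodule R R)) ≤ 0 := by
    by_contra! hcon
    have : (rs.length : WithBot ℕ∞) < rs.length := by
      conv_rhs => rw [← h]
      have h1 : (1 : WithBot ℕ∞) ≤ Module.supportDim R (R ⧸ Ideal.ofList rs • (⊤ : Submodule R R)) :=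
        by
        simpa using ENat.WithBot.add_one_le_iff (n := 0).mpr (by simpa using hcon)
      calc (rs.length : WithBot ℕ∞) < 1 + rs.length := by
            norm_cast
            omega
        _ ≤ _ := by gcongr
    exact lt_irrefl _ this
  obtain ⟨N, hN⟩ := exists_pow_smul_eq_bot_of_supportDim_le_zero h0
  refine ⟨N, fun x hx => ?_⟩
  have h1 : x • (Submodule.Quotient.mk 1 : R ⧸ Ideal.ofList rs • (⊤ : Submodule R R)) = 0 := by
    rw [← Submodule.mem_bot R, ← hN]
    exact Submodule.smul_mem_smul hx trivial
  rw [← Submodule.Quotient.mk_smul, Submodule.Quotient.mk_eq_zero] at h1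
  simpa using h1

/-- The dimension of a local ring is at most the length of a sequence generating an ideal that
contains a power of the maximal ideal. -/
theorem ringKrullDim_le_length {R : Type u} [CommRing R] [IsLocalRing R] [IsNoetherianRing R]
    {rs : List R} (hm : ∀ x ∈ rs, x ∈ maximalIdeal R) {N : ℕ}
    (h : maximalIdeal R ^ N ≤ Ideal.ofList rs) :
    ringKrullDim R ≤ rs.length := by
  classical
  rw [← IsLocalRing.maximalIdeal_height_eq_ringKrullDim]
  -- A prime containing the sequence contains a power of the maximal ideal, so Krull's height
  -- theorem applies to the maximal ideal itself.
  have hmin : maximalIdeal R ∈ (Ideal.ofList rs).minimalPrimes := by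
    refine ⟨⟨inferInstance, Ideal.span_le.mpr fun x hx => hm x hx⟩, fun q hq _ => ?_⟩
    exact hq.1.le_of_pow_le (h.trans hq.2)
  have hspan : Ideal.ofList rs = Ideal.span (rs.toFinset : Set R) := by
    simp [Ideal.ofList]
  rw [hspan] at hmin
  have h2 : (maximalIdeal R).height ≤ rs.length :=
    (Ideal.height_le_card_of_mem_minimalPrimes_span_finset hmin).trans
      (by exact_mod_cast List.toFinset_card_le rs)
  exact_mod_cast h2

end CohenMacaulay

/-! ### Invariance of length under flat base change -/

section BaseChangeLength

open TensorProduct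

/-- Flat base change along which the maximal ideal `m` extends to a maximal ideal preserves the
length of modules killed by a power of `m`. -/
theorem length_baseChange_eq {R S : Type*} [CommRing R] [CommRing S] [Algebra R S]
    [Module.Flat R S] (m : Ideal R) [m.IsMaximal] (hm : (m.map (algebraMap R S)).IsMaximal)
    {M : Type*} [AddCommGroup M] [Module R M] (hfin : IsFiniteLength R M) {n : ℕ}
    (hM : ∀ r ∈ m ^ n, ∀ x : M, r • x = 0) :
    Module.length S (S ⊗[R] M) = Module.length R M := by
  induction hfin with
  | of_subsingleton =>
    rw [Module.length_eq_zero, Module.length_eq_zero]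
  | @of_simple_quotient M _ _ N hsimple _ ih =>
    have hN := ih (fun r hr x => Subtype.ext (hM r hr x))
    have hexact : Function.Exact N.subtype N.mkQ := by
      rw [LinearMap.exact_iff]; simp
    rw [Module.length_eq_add_of_exact N.subtype N.mkQ N.injective_subtype N.mkQ_surjective hexact,
      Module.length_eq_add_of_exact (AlgebraTensorModule.lTensor S S N.subtype)
        (AlgebraTensorModule.lTensor S S N.mkQ)
        (Module.Flat.lTensor_preserves_injective_linearMap _ N.injective_subtype)
        (LinearMap.lTensor_surjective S N.mkQ_surjective)
        (lTensor_exact S hexact N.mkQ_surjective), hN]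
    congr 1
    obtain ⟨I, hI, ⟨e⟩⟩ := isSimpleModule_iff_quot_maximal.mp hsimple
    -- Since `m^n` kills `M`, it lies in the annihilator `I` of the simple factor. Every composition
    -- factor is thus `R/m`, whose base change `S/mS` is again simple.
    have hIm : m = I := by
      refine ‹m.IsMaximal›.eq_of_le hI.ne_top (hI.isPrime.le_of_pow_le (n := n) fun r hr => ?_)
      obtain ⟨y, hy⟩ := e.surjective 1
      obtain ⟨z, rfl⟩ := N.mkQ_surjective y
      rw [← Ideal.Quotient.eq_zero_iff_mem]
      have h1 : r • e (N.mkQ z) = 0 := by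
        rw [← map_smul, ← map_smul, hM r hr, map_zero, map_zero]
      rw [hy] at h1
      rw [← h1, Algebra.smul_def, mul_one]
      rfl
    subst hIm
    have e2 : S ⊗[R] (M ⧸ N) ≃ₗ[S] S ⧸ m.map (algebraMap R S) :=
      (AlgebraTensorModule.congr (LinearEquiv.refl S S) e).trans
        (Algebra.TensorProduct.quotIdealMapEquivTensorQuot S m).symm.toLinearEquiv
    rw [e2.length_eq, Module.length_eq_one R (M ⧸ N)]
    have : IsSimpleModule S (S ⧸ m.map (algebraMap R S)) :=
      isSimpleModule_iff_quot_maximal.mpr ⟨_, hm, ⟨LinearEquiv.refl _ _⟩⟩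
    exact Module.length_eq_one S _

end BaseChangeLength

/-! ### Type plus one is at most the multiplicity -/

section CMType

open IsLocalRing

/-- The socle of a local ring of finite length greater than one is a proper ideal. -/
theorem length_hom_add_one_le {R : Type*} [CommRing R] [IsLocalRing R] {I : Ideal R}
    (hfin : Module.length R (R ⧸ I) ≠ ⊤) (h1 : 1 < Module.length R (R ⧸ I)) :
    Module.length R ((R ⧸ maximalIdeal R) →ₗ[R] (R ⧸ I)) + 1 ≤ Module.length R (R ⧸ I) := by
  let f : ((R ⧸ maximalIdeal R) →ₗ[R] (R ⧸ I)) →ₗ[R] (R ⧸ I) :=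
    LinearMap.applyₗ (Ideal.Quotient.mk _ 1)
  have hf : Function.Injective f := by
    intro g g' h
    ext
    exact h
  obtain ⟨hN, hA⟩ := isFiniteLength_iff_isNoetherian_isArtinian.mp (Module.length_ne_top_iff.mp hfin)
  -- If the socle contained 1, then `R/I` would be a quotient of the residue field and have length
  -- at most 1.
  have hr : LinearMap.range f ≠ ⊤ := by
    intro htop
    obtain ⟨g, hg⟩ : ∃ g, f g = Ideal.Quotient.mk I 1 := by
      rw [← LinearMap.mem_range, htop]; trivial
    have hs : Function.Surjective g := by
      intro y
      obtain ⟨y, rfl⟩ := Ideal.Quotient.mk_surjective y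
      refine ⟨y • Ideal.Quotient.mk _ 1, ?_⟩
      rw [map_smul]
      change y • f g = _
      rw [hg, Algebra.smul_def]
      simp
    have := Module.length_le_of_surjective g hs
    have hsimp : IsSimpleModule R (R ⧸ maximalIdeal R) :=
      isSimpleModule_iff_quot_maximal.mpr ⟨_, inferInstance, ⟨LinearEquiv.refl _ _⟩⟩
    rw [Module.length_eq_one R (R ⧸ maximalIdeal R)] at this
    exact absurd h1 (not_lt.mpr this)
  have hlt := Submodule.length_lt hr
  rw [← (LinearEquiv.ofInjective f hf).length_eq] at hlt
  exact Order.add_one_le_of_lt hlt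



theorem ExtMod.smul_eq_zero_of_mem {R : Type u} [CommRing R] {M : Type u} [AddCommGroup M]
    [Module R M] {I : Ideal R} {r : R} (hr : r ∈ I) {i : ℕ} (x : ExtMod R (R ⧸ I) M i) :
    r • x = 0 :=
  ExtMod.smul_eq_zero_of_left (fun y => by
    obtain ⟨y, rfl⟩ := Ideal.Quotient.mk_surjective y
    exact Ideal.Quotient.eq_zero_iff_mem.mpr (Ideal.mul_mem_right _ _ hr)) x

theorem ExtMod.length_ne_top {R : Type u} [CommRing R] [IsNoetherianRing R] (m : Ideal R)
    [m.IsMaximal] (i : ℕ) : Module.length R (ExtMod R (R ⧸ m) R i) ≠ ⊤ := by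
  have hfin : Module.Finite R (ExtMod R (R ⧸ m) R i) := ModuleCat.finite_ext _ _ _ _
  have h := length_quotient_pow_smul_ne_top (M := ExtMod R (R ⧸ m) R i) m 1
  have h0 : m ^ 1 • (⊤ : Submodule R (ExtMod R (R ⧸ m) R i)) = ⊥ := by
    rw [pow_one, eq_bot_iff, Submodule.smul_le]
    intro r hr x _
    exact (Submodule.mem_bot R).mpr (ExtMod.smul_eq_zero_of_mem hr x)
  rwa [(Submodule.quotEquivOfEqBot _ h0).length_eq] at h

/-- The `Ext` modules from `R ⧸ m` are computed after flat base change along which `m` extends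
to a maximal ideal. -/
theorem ExtMod.length_baseChange {R S : Type u} [CommRing R] [IsNoetherianRing R] [CommRing S]
    [Algebra R S] [Module.Flat R S] (m : Ideal R) [m.IsMaximal] {n : Ideal S} [n.IsMaximal]
    (hm : m.map (algebraMap R S) = n) (i : ℕ) :
    Module.length S (ExtMod S (S ⧸ n) S i) = Module.length R (ExtMod R (R ⧸ m) R i) := by
  subst hm
  rw [← length_baseChange_eq (S := S) (n := 1) m inferInstance
    (Module.length_ne_top_iff.mp (ExtMod.length_ne_top m i))
    (fun r hr => ExtMod.smul_eq_zero_of_mem (pow_one m ▸ hr))]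
  obtain ⟨e⟩ := ExtMod.nonempty_baseChange (R := R) S R i (R ⧸ m)
  exact ((e.trans (ExtMod.congr
    (Algebra.TensorProduct.quotIdealMapEquivTensorQuot S m).symm.toLinearEquiv
    (TensorProduct.AlgebraTensorModule.rid R S S) i)).length_eq).symm

theorem length_quotient_pow_baseChange {R S : Type*} [CommRing R] [IsNoetherianRing R]
    [CommRing S] [Algebra R S] [Module.Flat R S] (m : Ideal R) [m.IsMaximal] {n : Ideal S}
    [n.IsMaximal] (hm : m.map (algebraMap R S) = n) (i : ℕ) :
    Module.length S (S ⧸ n ^ i) = Module.length R (R ⧸ m ^ i) := by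
  subst hm
  have hfl : IsFiniteLength R (R ⧸ m ^ i) := by
    rw [← Module.length_ne_top_iff]
    have h := length_quotient_pow_smul_ne_top (M := R) m i
    rwa [(Submodule.quotEquivOfEq _ _ (by simp) : (R ⧸ m ^ i • (⊤ : Submodule R R)) ≃ₗ[R]
      R ⧸ m ^ i).length_eq] at h
  rw [← length_baseChange_eq (S := S) (n := i) m inferInstance hfl (fun r hr y => by
      obtain ⟨y, rfl⟩ := Ideal.Quotient.mk_surjective y
      exact Ideal.Quotient.eq_zero_iff_mem.mpr (Ideal.mul_mem_right _ _ hr))]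
  rw [← Ideal.map_pow]
  exact (Algebra.TensorProduct.quotIdealMapEquivTensorQuot S (m ^ i)).toLinearEquiv.length_eq

/-- A local ring with a regular sequence generating an ideal containing a power of the maximal
ideal: type plus one is at most the multiplicity. -/
theorem length_ext_add_one_le {S : Type u} [CommRing S] [IsLocalRing S] [IsNoetherianRing S]
    [Infinite (ResidueField S)] {rs : List S} (hrs : ∀ x ∈ rs, x ∈ maximalIdeal S)
    (hreg : RingTheory.Sequence.IsWeaklyRegular S rs) {N : ℕ}
    (hN : maximalIdeal S ^ N ≤ Ideal.ofList rs) {P : Polynomial ℚ}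
    (hP : ∀ᶠ n : ℕ in atTop,
      P.eval (n : ℚ) = ((Module.length S (S ⧸ maximalIdeal S ^ (n + 1))).toNat : ℚ))
    (h1 : 1 < (rs.length.factorial : ℚ) * P.coeff rs.length) :
    ((Module.length S (ExtMod S (S ⧸ maximalIdeal S) S rs.length)).toNat : ℚ) + 1 ≤
      (rs.length.factorial : ℚ) * P.coeff rs.length := by
  have hkill : ∀ {l : List S}, (∀ x ∈ l, x ∈ maximalIdeal S) → ∀ x ∈ l, ∀ y : S ⧸ maximalIdeal S,
      x • y = 0 := fun hl x hx y => by
    obtain ⟨y, rfl⟩ := Ideal.Quotient.mk_surjective y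
    exact Ideal.Quotient.eq_zero_iff_mem.mpr (Ideal.mul_mem_right _ _ (hl x hx))
  have hext := (ExtMod.of_isWeaklyRegular rs S hreg (hkill hrs)).1
  have hdim : Module.supportDim S S ≤ rs.length := by
    rw [Module.supportDim_self_eq_ringKrullDim]
    exact ringKrullDim_le_length hrs hN
  -- The given sequence only supplies the depth and the dimension. The new sequence `l` has the same
  -- length, and its quotient has length equal to the multiplicity.
  obtain ⟨-, l, hl, hlreg, hlen, hfin, hcoeff⟩ := exists_isWeaklyRegular_length_eq rs.length S hext
    hdim P (by
      filter_upwards [hP] with n hn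
      rw [hn, (Submodule.quotEquivOfEq _ _ (by simp) :
        (S ⧸ maximalIdeal S ^ (n + 1) • (⊤ : Submodule S S)) ≃ₗ[S]
          S ⧸ maximalIdeal S ^ (n + 1)).length_eq])
  obtain ⟨e⟩ := (ExtMod.of_isWeaklyRegular l S hlreg (hkill hl)).2
  have e' : (S ⧸ Ideal.ofList l • (⊤ : Submodule S S)) ≃ₗ[S] S ⧸ Ideal.ofList l :=
    Submodule.quotEquivOfEq _ _ (by simp)
  rw [e'.length_eq] at hfin hcoeff
  rw [hcoeff] at h1 ⊢
  rw [← hlen, (e.trans (LinearEquiv.congrRight e')).length_eq]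
  have hlt : 1 < Module.length S (S ⧸ Ideal.ofList l) := by
    rw [← ENat.natCast_toNat hfin]
    exact_mod_cast h1
  have h := length_hom_add_one_le hfin hlt
  have h2 : Module.length S ((S ⧸ maximalIdeal S) →ₗ[S] (S ⧸ Ideal.ofList l)) ≠ ⊤ :=
    ne_top_of_le_ne_top hfin (le_self_add.trans h)
  have h3 := ENat.toNat_le_toNat h hfin
  rw [ENat.toNat_add h2 (by simp)] at h3
  exact_mod_cast h3

/-- The type of a Cohen–Macaulay ring of multiplicity greater than one is less than the
multiplicity. -/
theorem cohenMacaulayType_add_one_le {R : Type u} [CommRing R] [IsNoetherianRing R] (m : Ideal R)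
    [m.IsMaximal] (h : IsCohenMacaulayLocal (Localization.AtPrime m))
    (he : 1 < ringMultiplicity R m) :
    (cohenMacaulayType R m : ℚ) + 1 ≤ ringMultiplicity R m := by
  let L := Localization.AtPrime m
  obtain ⟨rs, hrs, hreg, hd⟩ := h.exists_isRegular
  have hheight : m.height.toNat = rs.length := by
    rw [IsLocalization.AtPrime.ringKrullDim_eq_height m] at hd
    have : m.height = rs.length := by exact_mod_cast hd
    rw [this]; rfl
  have hLN := h.1
  obtain ⟨N, hN⟩ := exists_pow_le_ofList hreg hd
  obtain ⟨S, _, _, _, _, hflat, hmS, hinf⟩ := IsLocalRing.exists_flat_extension L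
  algebraize [(algebraMap L S).comp (algebraMap R L)]
  have hRL : Module.Flat R L := IsLocalization.flat L m.primeCompl
  have hRS : Module.Flat R S := Module.Flat.trans R L S
  have hmap : m.map (algebraMap R S) = maximalIdeal S := by
    rw [IsScalarTower.algebraMap_eq R L S, ← Ideal.map_map, Localization.AtPrime.map_eq_maximalIdeal,
      hmS]
  have hmem : ∀ x ∈ rs.map (algebraMap L S), x ∈ maximalIdeal S := by
    intro x hx
    obtain ⟨y, hy, rfl⟩ := List.mem_map.mp hx
    rw [← hmS]
    exact Ideal.mem_map_of_mem _ (hrs y hy)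
  have hpow : maximalIdeal S ^ N ≤ Ideal.ofList (rs.map (algebraMap L S)) := by
    rw [← hmS, ← Ideal.map_pow, ← Ideal.map_ofList]
    exact Ideal.map_mono hN
  unfold ringMultiplicity at he ⊢
  split_ifs at he ⊢ with hP
  · have hP' := hP.choose_spec
    rw [hheight] at he ⊢
    have := length_ext_add_one_le (P := hP.choose) hmem hreg.toIsWeaklyRegular.of_flat hpow (by
      filter_upwards [hP'] with n hn
      rw [hn, length_quotient_pow_baseChange m hmap]
      rfl) (by simpa using he)
    rw [List.length_map, ExtMod.length_baseChange m hmap] at this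
    rw [cohenMacaulayType, hheight]
    exact this
  -- Without a Hilbert–Samuel polynomial the multiplicity takes its default value 0, which `1 < e`
  -- excludes.
  · norm_num at he

end CMType

/-! ### Vanishing of `Ext` and injective dimension -/

namespace ExtMod

section Vanishing

variable {R : Type u} [CommRing R] {N₁ N₂ N₃ M : Type u} [AddCommGroup N₁] [Module R N₁]
  [AddCommGroup N₂] [Module R N₂] [AddCommGroup N₃] [Module R N₃] [AddCommGroup M] [Module R M]

theorem subsingleton_middle {f : N₁ →ₗ[R] N₂} {g : N₂ →ₗ[R] N₃} (hf : Function.Injective f)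
    (hfg : Function.Exact f g) (hg : Function.Surjective g) {n : ℕ}
    (h1 : Subsingleton (ExtMod R N₁ M n)) (h3 : Subsingleton (ExtMod R N₃ M n)) :
    Subsingleton (ExtMod R N₂ M n) := by
  obtain ⟨δ, ha, -, -⟩ := exists_contravariant M hf hfg hg
  refine subsingleton_of_forall_eq 0 fun x => ?_
  obtain ⟨y, rfl⟩ := (ha n x).1 (Subsingleton.elim _ _)
  rw [Subsingleton.elim y 0, map_zero]

theorem subsingleton_right {f : N₁ →ₗ[R] N₂} {g : N₂ →ₗ[R] N₃} (hf : Function.Injective f)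
    (hfg : Function.Exact f g) (hg : Function.Surjective g) {n : ℕ}
    (h1 : Subsingleton (ExtMod R N₁ M n)) (h2 : Subsingleton (ExtMod R N₂ M (n + 1))) :
    Subsingleton (ExtMod R N₃ M (n + 1)) := by
  obtain ⟨δ, -, -, hc⟩ := exists_contravariant M hf hfg hg
  refine subsingleton_of_forall_eq 0 fun x => ?_
  obtain ⟨y, rfl⟩ := (hc n x).1 (Subsingleton.elim _ _)
  rw [Subsingleton.elim y 0, map_zero]

/-- Dévissage: `N` is an iterated extension of modules `R/q` with `q` prime, and `q` contains `K`
because `K` kills `N`. -/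
theorem subsingleton_of_prime [IsNoetherianRing R] (K : Ideal R) (n : ℕ)
    (h : ∀ q : Ideal R, q.IsPrime → K ≤ q → Subsingleton (ExtMod R (R ⧸ q) M n))
    (N : Type u) [AddCommGroup N] [Module R N] [hN : Module.Finite R N]
    (hK : ∀ r ∈ K, ∀ x : N, r • x = 0) : Subsingleton (ExtMod R N M n) := by
  revert hK
  induction hN using IsNoetherianRing.induction_on_isQuotientEquivQuotientPrime R with
  | subsingleton N => exact fun _ => subsingleton_of_subsingleton_left n
  | quotient N p e =>
    intro hK
    have := h p.1 p.2 fun r hr => by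
      rw [← Ideal.Quotient.eq_zero_iff_mem]
      obtain ⟨y, hy⟩ := e.surjective 1
      have h1 : r • e y = 0 := by rw [← map_smul, hK r hr, map_zero]
      rw [hy, Algebra.smul_def, mul_one] at h1
      exact h1
    exact (congr e (LinearEquiv.refl R M) n).toEquiv.subsingleton
  | exact N₁ N₂ N₃ f g hf hg hfg h1 h3 =>
    intro hK
    refine subsingleton_middle hf hfg hg (h1 fun r hr x => hf ?_) (h3 fun r hr x => ?_)
    · rw [map_smul, hK r hr, map_zero]
    · obtain ⟨y, rfl⟩ := hg x
      rw [← map_smul, hK r hr, map_zero]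

/-- The cokernel of multiplication by `y` on `R ⧸ p` is `R ⧸ (p + (y))`. -/
theorem exact_mul_quotient (p : Ideal R) (y : R) :
    Function.Exact (LinearMap.lsmul R (R ⧸ p) y)
      (Submodule.factor (le_sup_left : p ≤ p ⊔ Ideal.span {y})) := by
  intro z
  obtain ⟨z, rfl⟩ := Ideal.Quotient.mk_surjective z
  constructor
  · intro hz
    have hz' : z ∈ p ⊔ Ideal.span {y} := Ideal.Quotient.eq_zero_iff_mem.mp hz
    obtain ⟨a, ha, b, hb, rfl⟩ := Submodule.mem_sup.mp hz'
    obtain ⟨c, rfl⟩ := Ideal.mem_span_singleton'.mp hb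
    refine ⟨Ideal.Quotient.mk p c, ?_⟩
    change Ideal.Quotient.mk p (y * c) = _
    rw [Ideal.Quotient.eq]
    have : y * c - (a + c * y) = -a := by ring
    rw [this]
    exact neg_mem ha
  · rintro ⟨w, hw⟩
    obtain ⟨w, rfl⟩ := Ideal.Quotient.mk_surjective w
    rw [← hw]
    change Ideal.Quotient.mk _ (y * w) = 0
    exact Ideal.Quotient.eq_zero_iff_mem.mpr
      (Ideal.mul_mem_right _ _ (Ideal.mem_sup_right (Ideal.mem_span_singleton_self y)))

theorem injective_mul_quotient {p : Ideal R} (hp : p.IsPrime) {y : R} (hy : y ∉ p) :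
    Function.Injective (LinearMap.lsmul R (R ⧸ p) y) := by
  refine (injective_iff_map_eq_zero _).mpr fun z hz => ?_
  obtain ⟨z, rfl⟩ := Ideal.Quotient.mk_surjective z
  have hz' : y * z ∈ p := Ideal.Quotient.eq_zero_iff_mem.mp hz
  exact Ideal.Quotient.eq_zero_iff_mem.mpr ((hp.mem_or_mem hz').resolve_left hy)

theorem pre_lsmul (y : R) (n : ℕ) (x : ExtMod R N₁ M n) :
    pre M (LinearMap.lsmul R N₁ y) n x = y • x := by
  have : LinearMap.lsmul R N₁ y = y • LinearMap.id := rfl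
  rw [this, pre_smul_id]
  rfl

/-- From the `Ext` sequence of `0 → R/p → R/p → R/(p + (y)) → 0`. This surjectivity is combined
below with Nakayama in the local case, and with annihilation in the graded case. -/
theorem surjective_smul_of_prime {p : Ideal R} (hp : p.IsPrime) {y : R} (hy : y ∉ p) {n : ℕ}
    (h : Subsingleton (ExtMod R (R ⧸ p ⊔ Ideal.span {y}) M (n + 1))) (x : ExtMod R (R ⧸ p) M n) :
    ∃ z : ExtMod R (R ⧸ p) M n, y • z = x := by
  obtain ⟨δ, -, hb, -⟩ := exists_contravariant M (injective_mul_quotient hp hy)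
    (exact_mul_quotient p y) (Submodule.factor_surjective _)
  obtain ⟨z, hz⟩ := (hb n x).1 (Subsingleton.elim _ _)
  exact ⟨z, by rw [← hz, pre_lsmul]⟩

theorem subsingleton_quotient_sup_span {p : Ideal R} (hp : p.IsPrime) {y : R} (hy : y ∉ p) {n : ℕ}
    (h1 : Subsingleton (ExtMod R (R ⧸ p) M n)) (h2 : Subsingleton (ExtMod R (R ⧸ p) M (n + 1))) :
    Subsingleton (ExtMod R (R ⧸ p ⊔ Ideal.span {y}) M (n + 1)) :=
  subsingleton_right (injective_mul_quotient hp hy)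
    (exact_mul_quotient p y) (Submodule.factor_surjective _) h1 h2

/-- If `Ext` out of the residue field of a Noetherian local ring vanishes above degree `d`, then
so does `Ext` out of every finite module. -/
theorem subsingleton_of_residueField [IsLocalRing R] [IsNoetherianRing R] [Module.Finite R M]
    {d : ℕ} (h : ∀ n, d < n → Subsingleton (ExtMod R (R ⧸ IsLocalRing.maximalIdeal R) M n))
    (N : Type u) [AddCommGroup N] [Module R N] [Module.Finite R N] {n : ℕ} (hn : d < n) :
    Subsingleton (ExtMod R N M n) := by
  have key : ∀ p : Ideal R, p.IsPrime → ∀ n, d < n → Subsingleton (ExtMod R (R ⧸ p) M n) := by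
    intro p
    induction p using WellFoundedGT.induction with
    | ind p ih =>
      intro hp n hn
      by_cases hpm : p = IsLocalRing.maximalIdeal R
      · subst hpm
        exact h n hn
      obtain ⟨y, hy, hyp⟩ := SetLike.exists_of_lt
        (lt_of_le_of_ne (IsLocalRing.le_maximalIdeal hp.ne_top) hpm)
      -- Primes containing `p + (y)` are strictly larger than `p`, so the induction from above
      -- covers them, in every degree beyond `d`.
      have h1 : Subsingleton (ExtMod R (R ⧸ p ⊔ Ideal.span {y}) M (n + 1)) := by
        refine subsingleton_of_prime (p ⊔ Ideal.span {y}) (n + 1) (fun q hq hpq => ?_) _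
          fun r hr x => ?_
        · refine ih q (lt_of_le_of_ne (le_sup_left.trans hpq) ?_) hq _ (by omega)
          rintro rfl
          exact hyp (hpq (Ideal.mem_sup_right (Ideal.mem_span_singleton_self y)))
        · obtain ⟨x, rfl⟩ := Ideal.Quotient.mk_surjective x
          exact Ideal.Quotient.eq_zero_iff_mem.mpr (Ideal.mul_mem_right _ _ hr)
      have hfin : Module.Finite R (ExtMod R (R ⧸ p) M n) := ModuleCat.finite_ext _ _ _ _
      -- Multiplication by `y`, an element of the maximal ideal, is surjective on a finite module;
      -- Nakayama makes the module zero.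
      have htop : (⊤ : Submodule R (ExtMod R (R ⧸ p) M n)) ≤
          IsLocalRing.maximalIdeal R • ⊤ := fun x _ => by
        obtain ⟨z, rfl⟩ := surjective_smul_of_prime hp hyp h1 x
        exact Submodule.smul_mem_smul hy trivial
      have hbot := Submodule.eq_bot_of_le_smul_of_le_jacobson_bot _ _ Module.Finite.fg_top htop
        (IsLocalRing.maximalIdeal_le_jacobson _)
      exact (Submodule.subsingleton_iff R).mp (subsingleton_of_bot_eq_top hbot.symm)
  exact subsingleton_of_prime ⊥ n (fun q hq _ => key q hq n hn) N fun r hr x => by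
    rw [(Submodule.mem_bot R).mp hr, zero_smul]

end Vanishing

end ExtMod

section InjectiveDimension

variable {R : Type u} [CommRing R]

theorem Module.Baer.of_subsingleton_ext {M : Type u} [AddCommGroup M] [Module R M]
    (h : ∀ I : Ideal R, Subsingleton (ExtMod R (R ⧸ I) M 1)) : Module.Baer R M := by
  intro I g
  have hex : Function.Exact I.subtype I.mkQ := by
    rw [LinearMap.exact_iff]; simp
  obtain ⟨δ, -, hb, -⟩ := ExtMod.exists_contravariant M I.injective_subtype hex I.mkQ_surjective
  have := h I
  obtain ⟨x, hx⟩ := (hb 0 ((ExtMod.zeroEquiv R I M).symm g)).1 (Subsingleton.elim _ _)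
  refine ⟨ExtMod.zeroEquiv R R M x, fun y hy => ?_⟩
  have h1 := congrArg (ExtMod.zeroEquiv R I M) hx
  rw [ExtMod.zeroEquiv_pre, LinearEquiv.apply_symm_apply] at h1
  exact LinearMap.congr_fun h1 ⟨y, hy⟩

/-- The injective dimension is detected by `Ext` out of cyclic modules. -/
theorem hasInjectiveDimensionLE_of_quotient (n : ℕ) (X : ModuleCat.{u} R)
    (h : ∀ I : Ideal R, Subsingleton (Abelian.Ext.{u} (ModuleCat.of.{u} R (R ⧸ I)) X (n + 1))) :
    HasInjectiveDimensionLE X n := by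
  induction n generalizing X with
  | zero =>
    have hX := Module.Baer.of_subsingleton_ext (M := X) h
    rw [HasInjectiveDimensionLE, zero_add, ← injective_iff_hasInjectiveDimensionLT_one,
      ← Module.injective_iff_injective_object]
    exact hX.injective
  | succ n ih =>
    obtain ⟨I, inj, f, monof⟩ := (inferInstance : EnoughInjectives (ModuleCat.{u} R)).1 X
    let T := ShortComplex.mk f (Limits.cokernel.π f) (Limits.cokernel.condition f)
    have hT : T.ShortExact := { exact := ShortComplex.exact_cokernel f }
    -- Dimension shifting along an injective embedding: `Ext^{n+1}` into the cokernel embeds in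
    -- `Ext^{n+2}` into `X`.
    refine (hT.hasInjectiveDimensionLT_X₃_iff n inj).mp (ih T.X₃ fun J => ?_)
    refine subsingleton_of_forall_eq 0 fun x => ?_
    have := h J
    obtain ⟨y, hy⟩ := Abelian.Ext.covariant_sequence_exact₃ _ hT x rfl (Subsingleton.elim _ _)
    have hI : HasInjectiveDimensionLT T.X₂ 1 := injective_iff_hasInjectiveDimensionLT_one.mp inj
    rw [← hy, y.eq_zero_of_hasInjectiveDimensionLT 1 (by omega), Abelian.Ext.zero_comp]

end InjectiveDimension

/-! ### Type at most one implies Gorenstein, locally -/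

section GorensteinLocal

open IsLocalRing

theorem Module.length_le_add_length_range {R A B C : Type*} [Ring R] [AddCommGroup A]
    [AddCommGroup B] [AddCommGroup C] [Module R A] [Module R B] [Module R C] {f : A →ₗ[R] B}
    {g : B →ₗ[R] C} (h : Function.Exact f g) :
    Module.length R B ≤ Module.length R A + Module.length R (LinearMap.range g) := by
  rw [Module.length_eq_add_of_exact (LinearMap.range f).subtype g.rangeRestrict
    (Submodule.injective_subtype _) (LinearMap.surjective_rangeRestrict _) (by
      rw [LinearMap.exact_iff, LinearMap.ker_rangeRestrict, Submodule.range_subtype]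
      exact LinearMap.exact_iff.mp h)]
  gcongr
  exact Module.length_le_of_surjective _ (LinearMap.surjective_rangeRestrict f)

namespace ExtMod

open scoped Pointwise

variable {R : Type u} [CommRing R]

theorem subsingleton_quotSMulTop_left {N M : Type u} [AddCommGroup N] [Module R N] [AddCommGroup M]
    [Module R M] {x : R} (hx : IsSMulRegular N x) {n : ℕ} (h1 : Subsingleton (ExtMod R N M n))
    (h2 : Subsingleton (ExtMod R N M (n + 1))) :
    Subsingleton (ExtMod R (QuotSMulTop x N) M (n + 1)) :=
  subsingleton_right (f := LinearMap.lsmul R N x) (by exact hx)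
    (LinearMap.exact_lsmul_mkQ_smul_top N x) (Submodule.mkQ_surjective _) h1 h2

/-- Each regular element raises by at most one the largest degree in which `Ext` out of the quotient
can be nonzero. -/
theorem subsingleton_quotient_ofList (M : Type u) [AddCommGroup M] [Module R M] (rs : List R) :
    ∀ (N : Type u) [AddCommGroup N] [Module R N] (d : ℕ),
    RingTheory.Sequence.IsWeaklyRegular N rs → (∀ n, d < n → Subsingleton (ExtMod R N M n)) →
    ∀ n, d + rs.length < n →
      Subsingleton (ExtMod R (N ⧸ Ideal.ofList rs • (⊤ : Submodule R N)) M n) := by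
  induction rs with
  | nil =>
    intro N _ _ d _ h n hn
    have := h n (by simpa using hn)
    exact (congr (Submodule.quotEquivOfEqBot (Ideal.ofList ([] : List R) • (⊤ : Submodule R N))
      (by simp)) (LinearEquiv.refl R M) n).toEquiv.subsingleton
  | cons x rs ih =>
    intro N _ _ d hreg h n hn
    rw [RingTheory.Sequence.isWeaklyRegular_cons_iff] at hreg
    rw [List.length_cons] at hn
    have := ih (QuotSMulTop x N) (d + 1) hreg.2 (fun j hj => by
      obtain ⟨j, rfl⟩ : ∃ i, j = i + 1 := ⟨j - 1, by omega⟩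
      exact subsingleton_quotSMulTop_left hreg.1 (h j (by omega)) (h (j + 1) (by omega))) n
        (by omega)
    exact (congr (Submodule.quotOfListConsSMulTopEquivQuotSMulTopInner N x rs)
      (LinearEquiv.refl R M) n).toEquiv.subsingleton

variable [IsLocalRing R] {M : Type u} [AddCommGroup M] [Module R M]

/-- The length of `Ext^n` is subadditive along a composition series, and each factor contributes at
most 1. -/
theorem length_le_of_length_le_one {n : ℕ}
    (h : Module.length R (ExtMod R (R ⧸ maximalIdeal R) M n) ≤ 1) {N : Type u} [AddCommGroup N]
    [Module R N] (hN : IsFiniteLength R N) :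
    Module.length R (ExtMod R N M n) ≤ Module.length R N := by
  induction hN with
  | of_subsingleton =>
    have := subsingleton_of_subsingleton_left (R := R) (N := ‹_›) (M := M) n
    rw [Module.length_eq_zero]
    exact zero_le
  | @of_simple_quotient N _ _ N' hsimple _ ih =>
    have hex : Function.Exact N'.subtype N'.mkQ := by
      rw [LinearMap.exact_iff]; simp
    rw [Module.length_eq_add_of_exact N'.subtype N'.mkQ N'.injective_subtype N'.mkQ_surjective hex]
    obtain ⟨δ, ha, -, -⟩ := exists_contravariant M N'.injective_subtype hex N'.mkQ_surjective
    obtain ⟨I, hI, ⟨e⟩⟩ := isSimpleModule_iff_quot_maximal.mp hsimple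
    obtain rfl := eq_maximalIdeal hI
    rw [Module.length_eq_one R (N ⧸ N'), add_comm]
    have h1 : Module.length R (ExtMod R (N ⧸ N') M n) ≤ 1 :=
      (congr e (LinearEquiv.refl R M) n).length_eq.trans_le h
    exact (Module.length_le_add_length_range (ha n)).trans (add_le_add h1
      ((Module.length_le_of_injective _ (Submodule.injective_subtype _)).trans ih))

end ExtMod

/-- A Noetherian local ring whose Krull dimension is the length of a regular sequence and whose
type is at most one is Gorenstein. -/
theorem isGorensteinLocal_of_length_ext_le_one {R : Type u} [CommRing R] [IsLocalRing R]
    [IsNoetherianRing R] {rs : List R} (hrs : ∀ x ∈ rs, x ∈ maximalIdeal R)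
    (hreg : RingTheory.Sequence.IsWeaklyRegular R rs) {N : ℕ}
    (hN : maximalIdeal R ^ N ≤ Ideal.ofList rs)
    (h : Module.length R (ExtMod R (R ⧸ maximalIdeal R) R rs.length) ≤ 1) :
    IsGorensteinLocal R := by
  set d := rs.length with hd
  let I := Ideal.ofList rs
  have hIm : I ≤ maximalIdeal R := Ideal.span_le.mpr fun x hx => hrs x hx
  let e' : (R ⧸ I • (⊤ : Submodule R R)) ≃ₗ[R] R ⧸ I := Submodule.quotEquivOfEq _ _ (by simp)
  have hQ : ∀ n, d < n → Subsingleton (ExtMod R (R ⧸ I) R n) := fun n hn => by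
    have := ExtMod.subsingleton_quotient_ofList R rs R 0 hreg (fun j hj => by
      obtain ⟨j, rfl⟩ : ∃ i, j = i + 1 := ⟨j - 1, by omega⟩
      exact ExtMod.subsingleton_of_projective j) n (by omega)
    exact (ExtMod.congr e'.symm (LinearEquiv.refl R R) n).toEquiv.subsingleton
  have hfin : Module.length R (R ⧸ I) ≠ ⊤ := by
    have h1 := length_quotient_pow_smul_ne_top (M := R) (maximalIdeal R) N
    refine ne_top_of_le_ne_top h1 (Module.length_le_of_surjective (Submodule.factor (?_ : _ ≤ I))
      (Submodule.factor_surjective _))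
    simpa using hN
  -- Here `Ext^d(R/I, R) ≅ Hom(R/I, R/I) ≅ R/I`, so `R/I` attains the bound of
  -- `length_le_of_length_le_one`.
  have hQd : Module.length R (ExtMod R (R ⧸ I) R d) = Module.length R (R ⧸ I) := by
    obtain ⟨e⟩ := (ExtMod.of_isWeaklyRegular (N := R ⧸ I) rs R hreg (fun x hx y => by
      obtain ⟨y, rfl⟩ := Ideal.Quotient.mk_surjective y
      exact Ideal.Quotient.eq_zero_iff_mem.mpr
        (Ideal.mul_mem_right _ _ (Ideal.subset_span hx)))).2
    rw [(e.trans (LinearEquiv.congrRight e')).length_eq]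
    let ev : ((R ⧸ I) →ₗ[R] (R ⧸ I)) →ₗ[R] (R ⧸ I) := LinearMap.applyₗ (Ideal.Quotient.mk _ 1)
    refine (LinearEquiv.ofBijective ev ⟨fun f g hfg => ?_, fun y => ?_⟩).length_eq
    · ext
      exact hfg
    · obtain ⟨y, rfl⟩ := Ideal.Quotient.mk_surjective y
      refine ⟨LinearMap.lsmul R (R ⧸ I) y, ?_⟩
      change Ideal.Quotient.mk I (y * 1) = _
      rw [mul_one]
  let g : (R ⧸ I) →ₗ[R] R ⧸ maximalIdeal R := Submodule.factor hIm
  have hg : Function.Surjective g := Submodule.factor_surjective _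
  let K := LinearMap.ker g
  have hex : Function.Exact K.subtype g := by
    rw [LinearMap.exact_iff]; simp [K]
  have hKfl : IsFiniteLength R K := by
    rw [← Module.length_ne_top_iff]
    exact ne_top_of_le_ne_top hfin (Module.length_le_of_injective _ K.injective_subtype)
  have hsimple : IsSimpleModule R (R ⧸ maximalIdeal R) :=
    isSimpleModule_iff_quot_maximal.mpr ⟨_, inferInstance, ⟨LinearEquiv.refl _ _⟩⟩
  have hlen : Module.length R (R ⧸ I) = Module.length R K + 1 := by
    rw [Module.length_eq_add_of_exact K.subtype g K.injective_subtype hg hex,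
      Module.length_eq_one R (R ⧸ maximalIdeal R)]
  obtain ⟨δ, ha, hb, hc⟩ := ExtMod.exists_contravariant R K.injective_subtype hex hg
  -- With `Q = R/I`, the image of `Ext^d(Q, R)` in `Ext^d(K, R)` has length at least `ℓ(Q) - 1 =
  -- ℓ(K)`, and `Ext^d(K, R)` has length at most `ℓ(K)`. The map is onto, so `Ext^{d+1}(k, R)`
  -- injects into `Ext^{d+1}(Q, R) = 0`.
  have hk1 : Subsingleton (ExtMod R (R ⧸ maximalIdeal R) R (d + 1)) := by
    have hKle := ExtMod.length_le_of_length_le_one h hKfl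
    have hKE : Module.length R (ExtMod R K R d) ≠ ⊤ :=
      ne_top_of_le_ne_top (Module.length_ne_top_iff.mpr hKfl) hKle
    have hQle : Module.length R (ExtMod R (R ⧸ I) R d) ≤
        1 + Module.length R (LinearMap.range (ExtMod.pre R K.subtype d)) :=
      (Module.length_le_add_length_range (ha d)).trans (by gcongr)
    have hrange : LinearMap.range (ExtMod.pre R K.subtype d) = ⊤ := by
      by_contra hne
      obtain ⟨hn, hA⟩ := isFiniteLength_iff_isNoetherian_isArtinian.mp
        (Module.length_ne_top_iff.mp hKE)
      have hlt := Submodule.length_lt hne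
      have h3 := (hlt.trans_le hKle)
      rw [hQd, hlen, add_comm] at hQle
      exact absurd h3 (not_lt.mpr ((ENat.add_le_add_iff_left ENat.one_ne_top).mp hQle))
    have := hQ (d + 1) (by omega)
    refine subsingleton_of_forall_eq 0 fun x => ?_
    obtain ⟨y, rfl⟩ := (hc d x).1 (Subsingleton.elim _ _)
    refine (hb d y).2 ?_
    change y ∈ LinearMap.range (ExtMod.pre R K.subtype d)
    rw [hrange]
    trivial
  -- All composition factors of `K` are `k`, so vanishing passes from `k` to `K`; the sequence, with
  -- no `Ext` out of `R/I` above `d`, then gives it for `k` one degree higher.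
  have hk : ∀ j, Subsingleton (ExtMod R (R ⧸ maximalIdeal R) R (d + 1 + j)) := by
    intro j
    induction j with
    | zero => exact hk1
    | succ j ih =>
      have h1 : Subsingleton (ExtMod R K R (d + 1 + j)) := by
        refine ExtMod.subsingleton_of_prime (maximalIdeal R ^ N) _ (fun q hq hNq => ?_) K
          fun r hr x => ?_
        · rwa [← (maximalIdeal.isMaximal R).eq_of_le hq.ne_top (hq.le_of_pow_le hNq)]
        · obtain ⟨⟨y⟩, hx⟩ := x
          exact Subtype.ext (Ideal.Quotient.eq_zero_iff_mem.mpr (Ideal.mul_mem_right y I (hN hr)))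
      exact ExtMod.subsingleton_right K.injective_subtype hex hg h1
        (hQ (d + 1 + j + 1) (by omega))
  refine ⟨inferInstance, d, hasInjectiveDimensionLE_of_quotient d _ fun J => ?_⟩
  refine ExtMod.subsingleton_of_residueField (d := d) (fun n hn => ?_) (R ⧸ J) (Nat.lt_succ_self d)
  obtain ⟨j, rfl⟩ : ∃ j, n = d + 1 + j := ⟨n - (d + 1), by omega⟩
  exact hk j

end GorensteinLocal

open IsLocalRing in
/-- A Cohen–Macaulay local ring of type at most one is Gorenstein. -/
theorem isGorensteinLocal_of_cohenMacaulayType_le_one {R : Type u} [CommRing R]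
    [IsNoetherianRing R] (m : Ideal R) [m.IsMaximal]
    (h : IsCohenMacaulayLocal (Localization.AtPrime m)) (h1 : cohenMacaulayType R m ≤ 1) :
    IsGorensteinLocal (Localization.AtPrime m) := by
  let L := Localization.AtPrime m
  have hLN := h.1
  obtain ⟨rs, hrs, hreg, hd⟩ := h.exists_isRegular
  have hheight : m.height.toNat = rs.length := by
    rw [IsLocalization.AtPrime.ringKrullDim_eq_height m] at hd
    have : m.height = rs.length := by exact_mod_cast hd
    rw [this]; rfl
  obtain ⟨N, hN⟩ := exists_pow_le_ofList hreg hd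
  refine isGorensteinLocal_of_length_ext_le_one hrs hreg.toIsWeaklyRegular hN ?_
  have hRL : Module.Flat R L := IsLocalization.flat L m.primeCompl
  rw [ExtMod.length_baseChange (R := R) (S := L) m Localization.AtPrime.map_eq_maximalIdeal]
  rw [cohenMacaulayType, hheight] at h1
  rw [← ENat.natCast_toNat (ExtMod.length_ne_top m rs.length)]
  exact_mod_cast h1

/-! ### Annihilators of `Ext` under localization and flat maps -/

namespace ExtMod

open TensorProduct

/-- Over a Noetherian ring whose localization at `m` has finite injective dimension `n`, the
higher `Ext` modules into the ring are killed by elements outside `m`. -/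
theorem exists_notMem_smul_eq_zero {R : Type u} [CommRing R] [IsNoetherianRing R] (m : Ideal R)
    [m.IsPrime] {n : ℕ}
    (h : HasInjectiveDimensionLE
      (ModuleCat.of.{u} (Localization.AtPrime m) (Localization.AtPrime m)) n)
    (N : Type u) [AddCommGroup N] [Module R N] [Module.Finite R N] {j : ℕ} (hj : n < j) :
    ∃ s ∉ m, ∀ x : ExtMod R N R j, s • x = 0 := by
  let L := Localization.AtPrime m
  have hRL : Module.Flat R L := IsLocalization.flat L m.primeCompl
  obtain ⟨e⟩ := nonempty_baseChange (R := R) L R j N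
  have h1 : Subsingleton (ExtMod L (L ⊗[R] N) L j) :=
    HasInjectiveDimensionLT.subsingleton (ModuleCat.of.{u} L L) (n + 1) j hj _
  have h2 : Subsingleton (L ⊗[R] ExtMod R N R j) :=
    (e.trans (congr (LinearEquiv.refl L _)
      (AlgebraTensorModule.rid R L L) j)).toEquiv.subsingleton
  have h3 : Subsingleton (LocalizedModule m.primeCompl (ExtMod R N R j)) :=
    (LocalizedModule.equivTensorProduct m.primeCompl (ExtMod R N R j)).toEquiv.subsingleton
  have hfin : Module.Finite R (ExtMod R N R j) := ModuleCat.finite_ext _ _ _ _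
  have h4 : (⟨m, inferInstance⟩ : PrimeSpectrum R) ∉ Module.support R (ExtMod R N R j) :=
    Module.notMem_support_iff.mpr h3
  rw [Module.mem_support_iff_of_finite] at h4
  obtain ⟨s, hs, hsm⟩ := SetLike.not_le_iff_exists.mp h4
  exact ⟨s, hsm, Module.mem_annihilator.mp hs⟩

/-- Annihilators of `Ext` extend along flat ring homomorphisms. -/
theorem smul_eq_zero_of_flat {R S : Type u} [CommRing R] [IsNoetherianRing R] [CommRing S]
    (φ : R →+* S) (hφ : φ.Flat) (J : Ideal R) {s : R} {j : ℕ}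
    (hs : ∀ x : ExtMod R (R ⧸ J) R j, s • x = 0) (x : ExtMod S (S ⧸ J.map φ) S j) :
    φ s • x = 0 := by
  algebraize [φ]
  obtain ⟨e⟩ := nonempty_baseChange (R := R) S R j (R ⧸ J)
  let e' := e.trans (congr (Algebra.TensorProduct.quotIdealMapEquivTensorQuot S J).symm.toLinearEquiv
    (AlgebraTensorModule.rid R S S) j)
  obtain ⟨y, rfl⟩ := e'.surjective x
  rw [← map_smul]
  have : φ s • y = 0 := by
    induction y with
    | zero => rw [smul_zero]
    | add a b ha hb => rw [smul_add, ha, hb, add_zero]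
    | tmul a b =>
      rw [smul_tmul', show φ s • a = s • a from (Algebra.smul_def s a).symm, smul_tmul, hs,
        tmul_zero]
  rw [this, map_zero]

/-- If `f` kills the base change to a flat algebra `S` of an `Ext` module, then the values of
`R`-linear functionals at `f` kill the `Ext` module. -/
theorem apply_smul_eq_zero_of_flat {R S : Type u} [CommRing R] [IsNoetherianRing R] [CommRing S]
    [Algebra R S] [Module.Flat R S] (J : Ideal R) {f : S} {j : ℕ}
    (hf : ∀ x : ExtMod S (S ⧸ J.map (algebraMap R S)) S j, f • x = 0) (c : S →ₗ[R] R)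
    (x : ExtMod R (R ⧸ J) R j) : c f • x = 0 := by
  obtain ⟨e⟩ := nonempty_baseChange (R := R) S R j (R ⧸ J)
  let e' := e.trans (congr (Algebra.TensorProduct.quotIdealMapEquivTensorQuot S J).symm.toLinearEquiv
    (AlgebraTensorModule.rid R S S) j)
  -- Thus `f ⊗ x = 0` in `S ⊗ Ext`, and applying `c ⊗ id` yields `c(f) x = 0`.
  have h1 : f • ((1 : S) ⊗ₜ[R] x) = 0 := by
    apply e'.injective
    rw [map_smul, hf, map_zero]
  rw [smul_tmul', smul_eq_mul, mul_one] at h1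
  have h2 := congrArg (LinearMap.rTensor (ExtMod R (R ⧸ J) R j) c) h1
  rw [map_zero, LinearMap.rTensor_tmul] at h2
  have h3 := congrArg (TensorProduct.lid R (ExtMod R (R ⧸ J) R j)) h2
  rwa [map_zero, TensorProduct.lid_tmul] at h3

end ExtMod

/-! ### The coaction of a grading and homogeneous ideals -/

section Grading

open LaurentPolynomial DirectSum

variable {R : Type u} [CommRing R] (𝒜 : ℕ → AddSubgroup R) [GradedRing 𝒜]

/-- The ring homomorphism `R → R[T;T⁻¹]` of a graded ring `R` that sends a homogeneous element `a`
of degree `i` to `a T ^ (z i)`. -/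
noncomputable def gradingHom (z : ℤ) : R →+* R[T;T⁻¹] :=
  (DirectSum.toSemiring (fun i : ℕ => (AddMonoidHom.mulRight (T (z * i) : R[T;T⁻¹])).comp
    ((C : R →+* R[T;T⁻¹]).toAddMonoidHom.comp (𝒜 i).subtype))
    (by
      change C (1 : R) * T (z * (0 : ℕ)) = 1
      simp)
    (by
      intro i j a b
      change C ((a : R) * b) * T (z * ((i + j : ℕ) : ℤ)) = C (a : R) * T (z * i) * (C (b : R) * T (z * j))
      rw [map_mul, Nat.cast_add, mul_add, T_add]
      ring)).comp (decomposeRingEquiv 𝒜 : R →+* ⨁ i, 𝒜 i)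

theorem gradingHom_of_mem (z : ℤ) {i : ℕ} {a : R} (ha : a ∈ 𝒜 i) :
    gradingHom 𝒜 z a = C a * T (z * i) := by
  lift a to 𝒜 i using ha
  rw [gradingHom, RingHom.comp_apply]
  change DirectSum.toSemiring _ ?_ ?_ (decompose 𝒜 (a : R)) = _
  rw [decompose_coe]
  exact DirectSum.toAddMonoid_of _ _ _

theorem gradingHom_eq_sum [DecidableEq R] (z : ℤ) (a : R) :
    gradingHom 𝒜 z a = ∑ i ∈ (decompose 𝒜 a).support, C (decompose 𝒜 a i : R) * T (z * i) := by
  conv_lhs => rw [← DirectSum.sum_support_decompose 𝒜 a, map_sum]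
  exact Finset.sum_congr rfl fun i _ => gradingHom_of_mem 𝒜 z (SetLike.coe_mem _)

theorem coeff_zero_gradingHom (a : R) :
    (gradingHom 𝒜 1 a).coeff 0 = (decompose 𝒜 a 0 : R) := by
  induction a using DirectSum.Decomposition.inductionOn 𝒜 with
  | zero => simp
  | add a b ha hb =>
    rw [map_add, AddMonoidAlgebra.coeff_add, Finsupp.add_apply, ha, hb, decompose_add]
    rfl
  | @homogeneous i a =>
    rw [gradingHom_of_mem 𝒜 1 a.2, one_mul, ← LaurentPolynomial.single_eq_C_mul_T]
    rw [AddMonoidAlgebra.coeff_single, decompose_coe]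
    by_cases hi : i = 0
    · subst hi
      simp
    · rw [Finsupp.single_apply, if_neg (by exact_mod_cast hi), DirectSum.of_eq_of_ne _ _ _ (Ne.symm hi)]
      simp

/-- The endomorphism of `R[T;T⁻¹]` that fixes `T` and extends `gradingHom`. -/
noncomputable def gradingEnd (z : ℤ) : R[T;T⁻¹] →+* R[T;T⁻¹] :=
  eval₂ (gradingHom 𝒜 z) (isUnit_T 1).unit

theorem gradingEnd_T (z n : ℤ) : gradingEnd 𝒜 z (T n) = T n := by
  have h : ∀ n : ℕ, gradingEnd 𝒜 z (T n) = T n := fun n => by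
    rw [gradingEnd, eval₂_T_n, IsUnit.unit_spec, T_pow, mul_one]
  obtain ⟨n, rfl | rfl⟩ := n.eq_nat_or_neg
  · exact h n
  · refine (isUnit_T (n : ℤ)).mul_right_cancel ?_
    conv_lhs => rw [← h n]
    rw [← map_mul, ← T_add, neg_add_cancel, T_zero, map_one]

/-- For `z = 1` and `w = -1`, in both orders, this makes `gradingEnd 𝒜 1` an automorphism of
`R[T;T⁻¹]`. -/
theorem gradingEnd_comp (z w : ℤ) (hzw : z + w = 0) (f : R[T;T⁻¹]) :
    gradingEnd 𝒜 z (gradingEnd 𝒜 w f) = f := by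
  induction f using LaurentPolynomial.induction_on' with
  | add p q hp hq => rw [map_add, map_add, hp, hq]
  | C_mul_T n a =>
    rw [map_mul, map_mul, gradingEnd_T, gradingEnd_T]
    congr 1
    induction a using DirectSum.Decomposition.inductionOn 𝒜 with
    | zero => simp
    | add a b ha hb => rw [map_add, map_add, map_add, ha, hb]
    | @homogeneous i a =>
      rw [gradingEnd, gradingEnd, eval₂_C, gradingHom_of_mem 𝒜 w a.2, map_mul, eval₂_C,
        gradingHom_of_mem 𝒜 z a.2]
      have := gradingEnd_T 𝒜 z (w * i)
      rw [gradingEnd] at this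
      rw [this, mul_assoc, ← T_add, ← add_mul, hzw, zero_mul, T_zero, mul_one]

/-- The coaction is the flat inclusion of `R` in `R[T;T⁻¹]` followed by an automorphism. -/
theorem gradingHom_flat : (gradingHom 𝒜 1).Flat := by
  have h1 : gradingHom 𝒜 1 = (gradingEnd 𝒜 1).comp (algebraMap R R[T;T⁻¹]) := by
    ext1 a
    exact (eval₂_C _ _ a).symm
  rw [h1]
  refine RingHom.Flat.comp ?_ (RingHom.Flat.of_bijective ?_)
  · rw [RingHom.flat_algebraMap_iff]
    infer_instance
  · exact ⟨Function.LeftInverse.injective (gradingEnd_comp 𝒜 (-1) 1 (by norm_num)),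
      Function.RightInverse.surjective (gradingEnd_comp 𝒜 1 (-1) (by norm_num))⟩

/-- On a homogeneous element the coaction and the inclusion differ by the unit `T^i`. This lets an
annihilator transported along the coaction be read back along the inclusion. -/
theorem map_gradingHom {J : Ideal R} (hJ : J.IsHomogeneous 𝒜) :
    J.map (gradingHom 𝒜 1) = J.map (algebraMap R R[T;T⁻¹]) := by
  classical
  refine le_antisymm (Ideal.map_le_iff_le_comap.mpr fun a ha => ?_)
    (Ideal.map_le_iff_le_comap.mpr fun a ha => ?_)
  · rw [Ideal.mem_comap, gradingHom_eq_sum]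
    exact Ideal.sum_mem _ fun i _ => Ideal.mul_mem_right _ _ (Ideal.mem_map_of_mem _ (hJ i ha))
  · rw [Ideal.mem_comap, ← DirectSum.sum_support_decompose 𝒜 a, map_sum]
    refine Ideal.sum_mem _ fun i _ => ?_
    have h1 : algebraMap R R[T;T⁻¹] (decompose 𝒜 a i : R) =
        gradingHom 𝒜 1 (decompose 𝒜 a i : R) * T (-i) := by
      rw [gradingHom_of_mem 𝒜 1 (SetLike.coe_mem _), mul_assoc, ← T_add, one_mul, add_neg_cancel,
        T_zero, mul_one]
      rfl
    rw [h1]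
    exact Ideal.mul_mem_right _ _ (Ideal.mem_map_of_mem _ (hJ i ha))

/-- Let `J` be a homogeneous ideal of a graded ring whose degree zero part is a field. If an element
outside the irrelevant ideal kills `Ext (R ⧸ J, R)`, then this module vanishes. -/
theorem ExtMod.subsingleton_of_isHomogeneous [IsNoetherianRing R] (h0 : IsField (𝒜 0))
    {J : Ideal R} (hJ : J.IsHomogeneous 𝒜) {j : ℕ} {s : R}
    (hs : s ∉ (HomogeneousIdeal.irrelevant 𝒜).toIdeal)
    (hsE : ∀ x : ExtMod R (R ⧸ J) R j, s • x = 0) : Subsingleton (ExtMod R (R ⧸ J) R j) := by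
  have h1 := ExtMod.smul_eq_zero_of_flat (gradingHom 𝒜 1) (gradingHom_flat 𝒜) J hsE
  rw [map_gradingHom 𝒜 hJ] at h1
  have h2 := ExtMod.apply_smul_eq_zero_of_flat J h1
    -- The functional is the coefficient of `T^0`; on the coaction of `s` it gives the degree zero
    -- part of `s`.
    (Finsupp.lapply 0 ∘ₗ (AddMonoidAlgebra.coeffLinearEquiv R).toLinearMap)
  have h3 : ((Finsupp.lapply 0 ∘ₗ (AddMonoidAlgebra.coeffLinearEquiv R).toLinearMap :
      R[T;T⁻¹] →ₗ[R] R)) (gradingHom 𝒜 1 s) = (decompose 𝒜 s 0 : R) := coeff_zero_gradingHom 𝒜 s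
  rw [h3] at h2
  have hne : decompose 𝒜 s 0 ≠ 0 := fun h => hs (by
    change s ∈ HomogeneousIdeal.irrelevant 𝒜
    rw [HomogeneousIdeal.mem_irrelevant_iff, GradedRing.proj_apply, h]
    rfl)
  obtain ⟨t, ht⟩ := h0.mul_inv_cancel hne
  refine subsingleton_of_forall_eq 0 fun x => ?_
  have h4 : (decompose 𝒜 s 0 : R) * (t : R) = 1 := congrArg Subtype.val ht
  rw [← one_smul R x, ← h4, mul_comm, mul_smul, h2, smul_zero]

theorem isMaximal_irrelevant (h0 : IsField (𝒜 0)) :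
    (HomogeneousIdeal.irrelevant 𝒜).toIdeal.IsMaximal := by
  let f := GradedRing.projZeroRingHom' 𝒜
  have hf : Function.Surjective f := GradedRing.projZeroRingHom'_surjective 𝒜
  let _ := h0.toField
  have h1 : (HomogeneousIdeal.irrelevant 𝒜).toIdeal = RingHom.ker f := by
    ext x
    change x ∈ HomogeneousIdeal.irrelevant 𝒜 ↔ _
    rw [HomogeneousIdeal.mem_irrelevant_iff, RingHom.mem_ker]
    exact ⟨fun h => Subtype.ext h, fun h => congrArg Subtype.val h⟩
  rw [h1]
  exact RingHom.ker_isMaximal_of_surjective f hf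

end Grading

/-! ### From homogeneous primes to all primes -/

section HomogeneousCore

open DirectSum

variable {R : Type u} [CommRing R] (𝒜 : ℕ → AddSubgroup R) [GradedRing 𝒜]

/-- Let `p` be a prime ideal with homogeneous core `q ≠ p`. There are `f ∈ p \ q` and a homogeneous
`a ∉ q` such that a power of `a` multiplies any given element of `p` into `q + (f)`. -/
theorem exists_pow_mul_mem_homogeneousCore_sup {p : Ideal R}
    (hne : ¬ p ≤ (p.homogeneousCore 𝒜).toIdeal) :
    ∃ f ∈ p, f ∉ (p.homogeneousCore 𝒜).toIdeal ∧ ∃ a ∉ (p.homogeneousCore 𝒜).toIdeal,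
      SetLike.IsHomogeneousElem 𝒜 a ∧
      ∀ g ∈ p, ∃ N : ℕ, a ^ N * g ∈ (p.homogeneousCore 𝒜).toIdeal ⊔ Ideal.span {f} := by
  classical
  set q := (p.homogeneousCore 𝒜).toIdeal with hq
  have hqp : q ≤ p := p.toIdeal_homogeneousCore_le 𝒜
  -- The property `W w` says that some element of `p` outside `q` has its components in a window of
  -- `w` consecutive degrees. An `f` of minimal width serves as divisor, with its lowest component
  -- as `a`.
  let W : ℕ → Prop := fun w => ∃ f ∈ p, f ∉ q ∧ ∃ b, ∀ i, ¬ (b ≤ i ∧ i < b + w) →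
    (decompose 𝒜 f i : R) = 0
  have hsupp : ∀ g : R, ∃ w, ∀ i, ¬ (0 ≤ i ∧ i < 0 + w) → (decompose 𝒜 g i : R) = 0 := fun g => by
    refine ⟨(decompose 𝒜 g).support.sup id + 1, fun i hi => ?_⟩
    by_contra h
    have h1 : i ∈ (decompose 𝒜 g).support := by
      rw [DFinsupp.mem_support_iff]
      exact fun h2 => h (by rw [h2]; rfl)
    have h2 : i ≤ (decompose 𝒜 g).support.sup id := Finset.le_sup (f := id) h1
    omega
  have hW : ∃ w, W w := by
    obtain ⟨f, hf, hfq⟩ := SetLike.not_le_iff_exists.mp hne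
    obtain ⟨w, hw⟩ := hsupp f
    exact ⟨w, f, hf, hfq, 0, hw⟩
  obtain ⟨f, hfp, hfq, b, hb⟩ := Nat.find_spec hW
  set w := Nat.find hW with hw
  have hmin : ∀ g ∈ p, ∀ c v, v < w → (∀ i, ¬ (c ≤ i ∧ i < c + v) → (decompose 𝒜 g i : R) = 0) →
      g ∈ q := fun g hg c v hv hs => by
    by_contra hgq
    exact Nat.find_min hW hv ⟨g, hg, hgq, c, hs⟩
  have hzero : ∀ g : R, (∀ i, (decompose 𝒜 g i : R) = 0) → g = 0 := fun g hg => by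
    rw [← DirectSum.sum_support_decompose 𝒜 g]
    exact Finset.sum_eq_zero fun i _ => hg i
  have hw0 : 0 < w := by
    by_contra h
    refine hfq ?_
    rw [hzero f fun i => hb i (by omega)]
    exact q.zero_mem
  let a : R := decompose 𝒜 f b
  have ha : a ∈ 𝒜 b := SetLike.coe_mem _
  -- If `a` were in `q`, then `f - a` would be a narrower element of `p`, hence in `q` by
  -- minimality, and `f` would be in `q`.
  have haq : a ∉ q := fun haq => by
    have h1 := hmin (f - a) (p.sub_mem hfp (hqp haq)) (b + 1) (w - 1) (by omega) fun i hi => by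
      rw [decompose_sub, DirectSum.sub_apply, AddSubgroup.coe_sub]
      by_cases hib : b = i
      · subst hib
        rw [decompose_of_mem_same 𝒜 ha, sub_self]
      · rw [decompose_of_mem_ne 𝒜 ha hib, sub_zero]
        exact hb i (by omega)
    exact hfq (by simpa using q.add_mem h1 haq)
  refine ⟨f, hfp, hfq, a, haq, ⟨b, ha⟩, ?_⟩
  -- Pseudo-division by `f`, by induction on the width of `g`.
  have key : ∀ v c, ∀ g ∈ p, (∀ i, ¬ (c ≤ i ∧ i < c + v) → (decompose 𝒜 g i : R) = 0) →
      ∃ N : ℕ, a ^ N * g ∈ q ⊔ Ideal.span {f} := by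
    intro v
    induction v with
    | zero =>
      intro c g hg hs
      exact ⟨0, by simpa using Ideal.mem_sup_left (hmin g hg c 0 hw0 hs)⟩
    | succ v ih =>
      intro c g hg hs
      by_cases hv : v + 1 < w
      · exact ⟨0, by simpa using Ideal.mem_sup_left (hmin g hg c (v + 1) hv hs)⟩
      let e : R := decompose 𝒜 g c
      have he : e ∈ 𝒜 c := SetLike.coe_mem _
      -- The components in degree `b + c` cancel. Since `w ≤ v + 1`, what remains fits in a window
      -- of width `v` starting at `b + c + 1`.
      obtain ⟨N, hN⟩ := ih (b + c + 1) (a * g - e * f)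
        (p.sub_mem (p.mul_mem_left _ hg) (p.mul_mem_left _ hfp)) fun i hi => by
        rw [decompose_sub, DirectSum.sub_apply, AddSubgroup.coe_sub,
          coe_decompose_mul_of_left_mem 𝒜 i ha, coe_decompose_mul_of_left_mem 𝒜 i he]
        by_cases hi2 : i = b + c
        · subst hi2
          rw [if_pos (by omega), if_pos (by omega), Nat.add_sub_cancel, Nat.add_sub_cancel_left]
          exact sub_eq_zero.mpr (mul_comm _ _)
        · have h1 : (if b ≤ i then a * (decompose 𝒜 g (i - b) : R) else 0) = 0 := by
            split_ifs
            · rw [hs _ (by omega), mul_zero]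
            · rfl
          have h2 : (if c ≤ i then e * (decompose 𝒜 f (i - c) : R) else 0) = 0 := by
            split_ifs
            · rw [hb _ (by omega), mul_zero]
            · rfl
          rw [h1, h2, sub_zero]
      refine ⟨N + 1, ?_⟩
      have h3 : a ^ (N + 1) * g = a ^ N * (a * g - e * f) + a ^ N * e * f := by ring
      rw [h3]
      exact add_mem hN (Ideal.mul_mem_left _ _
        (Ideal.mem_sup_right (Ideal.mem_span_singleton_self f)))
  intro g hg
  obtain ⟨v, hv⟩ := hsupp g
  exact key v 0 g hg hv

theorem exists_pow_mul_mem_of_fg {p K : Ideal R} (hp : p.FG) {a : R}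
    (h : ∀ g ∈ p, ∃ N : ℕ, a ^ N * g ∈ K) : ∃ N : ℕ, ∀ g ∈ p, a ^ N * g ∈ K := by
  obtain ⟨S, rfl⟩ := hp
  choose! N hN using h
  refine ⟨S.sup N, fun g hg => ?_⟩
  induction hg using Submodule.span_induction with
  | mem x hx =>
    obtain ⟨k, hk⟩ := Nat.exists_eq_add_of_le (Finset.le_sup (f := N) hx)
    rw [hk, pow_add, mul_comm (a ^ N x), mul_assoc]
    exact Ideal.mul_mem_left _ _ (hN x (Submodule.subset_span hx))
  | zero => simp
  | add x y _ _ hx hy => rw [mul_add]; exact add_mem hx hy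
  | smul r x _ hx =>
    rw [smul_eq_mul, mul_left_comm]
    exact Ideal.mul_mem_left _ _ hx

namespace ExtMod

/-- The kernel `p/K` of `R/K → R/p` is killed by `s`, and its `Ext^j` surjects onto `Ext^{j+1}(R/p,
M)`. -/
theorem smul_eq_zero_of_factor {K p : Ideal R} (hKp : K ≤ p) {s : R} (hs : ∀ g ∈ p, s * g ∈ K)
    {M : Type u} [AddCommGroup M] [Module R M] {j : ℕ}
    (h : Subsingleton (ExtMod R (R ⧸ K) M (j + 1))) (x : ExtMod R (R ⧸ p) M (j + 1)) :
    s • x = 0 := by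
  let g : (R ⧸ K) →ₗ[R] R ⧸ p := Submodule.factor hKp
  have hex : Function.Exact (LinearMap.ker g).subtype g := by
    rw [LinearMap.exact_iff]; simp
  obtain ⟨δ, -, -, hc⟩ := exists_contravariant M (LinearMap.ker g).injective_subtype hex
    (Submodule.factor_surjective hKp)
  obtain ⟨y, rfl⟩ := (hc j x).1 (Subsingleton.elim _ _)
  rw [← map_smul, smul_eq_zero_of_left (fun z => ?_) y, map_zero]
  obtain ⟨z, hz⟩ := z
  obtain ⟨z, rfl⟩ := Ideal.Quotient.mk_surjective z
  exact Subtype.ext (Ideal.Quotient.eq_zero_iff_mem.mpr (hs z (Ideal.Quotient.eq_zero_iff_mem.mp hz)))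

/-- Over a graded Noetherian ring, vanishing of higher `Ext` modules out of quotients by homogeneous
prime ideals implies vanishing out of quotients by all prime ideals, one degree later. -/
theorem subsingleton_of_isPrime_isHomogeneous [IsNoetherianRing R] {M : Type u} [AddCommGroup M]
    [Module R M] {d : ℕ}
    (h : ∀ q : Ideal R, q.IsPrime → q.IsHomogeneous 𝒜 → ∀ j, d < j →
      Subsingleton (ExtMod R (R ⧸ q) M j)) {p : Ideal R} (hp : p.IsPrime) {j : ℕ}
    (hj : d + 1 < j) : Subsingleton (ExtMod R (R ⧸ p) M j) := by
  generalize hq : (p.homogeneousCore 𝒜).toIdeal = q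
  induction q using WellFoundedGT.induction generalizing p j with
  | ind q ih =>
    have hqp : q ≤ p := hq ▸ p.toIdeal_homogeneousCore_le 𝒜
    have hqprime : q.IsPrime := hq ▸ hp.homogeneousCore
    have hqhom : q.IsHomogeneous 𝒜 := hq ▸ (p.homogeneousCore 𝒜).isHomogeneous
    by_cases hpq : p ≤ q
    · obtain rfl := le_antisymm hpq hqp
      exact h _ hp hqhom j (by omega)
    obtain ⟨f, hfp, hfq, a, haq, hahom, hpow⟩ :=
      exists_pow_mul_mem_homogeneousCore_sup 𝒜 (p := p) (by rwa [hq])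
    rw [hq] at hfq haq hpow
    obtain ⟨N, hN⟩ := exists_pow_mul_mem_of_fg (IsNoetherian.noetherian p) hpow
    obtain ⟨j, rfl⟩ : ∃ i, j = i + 1 := ⟨j - 1, by omega⟩
    have hcore : ∀ p' : Ideal R, a ∈ p' → a ∈ (p'.homogeneousCore 𝒜).toIdeal := fun p' h' =>
      Ideal.mem_homogeneousCore_of_homogeneous_of_mem hahom h'
    have hap : a ^ N ∉ p := fun h' => haq (hq ▸ hcore p (hp.mem_of_pow_mem N h'))
    -- With `a^N p ⊆ q + (f)`, the element `a^N` kills `Ext^{j+1}(R/p, M)`. Vanishing for `R/(q +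
    -- (f))` uses two consecutive degrees for `R/q`, which is where the extra degree is lost.
    have hkill := smul_eq_zero_of_factor (M := M) (j := j)
      (sup_le hqp ((Ideal.span_singleton_le_iff_mem p).mpr hfp)) hN
      (subsingleton_quotient_sup_span hqprime hfq (h q hqprime hqhom j (by omega))
        (h q hqprime hqhom (j + 1) (by omega)))
    -- A prime containing `p` and `a` has a homogeneous core containing `q` and `a`, hence strictly
    -- larger than `q`. So `a^N` also acts surjectively on `Ext^{j+1}(R/p, M)`, which must be zero.
    have hvan : Subsingleton (ExtMod R (R ⧸ p ⊔ Ideal.span {a ^ N}) M (j + 1 + 1)) := by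
      refine subsingleton_of_prime (p ⊔ Ideal.span {a ^ N}) _ (fun q' hq' hle => ?_) _
        fun r hr x => ?_
      · have haq' : a ∈ q' := hq'.mem_of_pow_mem N
          (hle (Ideal.mem_sup_right (Ideal.mem_span_singleton_self _)))
        refine ih _ (lt_of_le_of_ne ?_ ?_) hq' (by omega) rfl
        · rw [← hq]
          exact Ideal.homogeneousCore_mono 𝒜 (le_sup_left.trans hle)
        · rintro rfl
          exact haq (hcore q' haq')
      · obtain ⟨x, rfl⟩ := Ideal.Quotient.mk_surjective x
        exact Ideal.Quotient.eq_zero_iff_mem.mpr (Ideal.mul_mem_right _ _ hr)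
    refine subsingleton_of_forall_eq 0 fun x => ?_
    obtain ⟨z, rfl⟩ := surjective_smul_of_prime hp hap hvan x
    exact hkill z

end ExtMod

open TensorProduct in
-- Every ideal of the localization is extended from `R`, so `Ext` out of its cyclic modules is a
-- localization of a vanishing module.
theorem isGorensteinLocal_localization_of_subsingleton [IsNoetherianRing R] {d : ℕ}
    (h : ∀ I : Ideal R, Subsingleton (ExtMod R (R ⧸ I) R (d + 1))) (p : Ideal R) [p.IsPrime] :
    IsGorensteinLocal (Localization.AtPrime p) := by
  let L := Localization.AtPrime p
  have hRL : Module.Flat R L := IsLocalization.flat L p.primeCompl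
  refine ⟨IsLocalization.isNoetherianRing p.primeCompl L inferInstance, d,
    hasInjectiveDimensionLE_of_quotient d _ fun J => ?_⟩
  let I := J.comap (algebraMap R L)
  have hJ : I.map (algebraMap R L) = J := IsLocalization.map_under p.primeCompl L J
  rw [← hJ]
  obtain ⟨e⟩ := ExtMod.nonempty_baseChange (R := R) L R (d + 1) (R ⧸ I)
  have := h I
  exact (e.trans (ExtMod.congr
    (Algebra.TensorProduct.quotIdealMapEquivTensorQuot L I).symm.toLinearEquiv
    (AlgebraTensorModule.rid R L L) (d + 1))).symm.toEquiv.subsingleton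

/-- A graded Noetherian ring whose degree zero part is a field is Gorenstein if its localization at
the irrelevant ideal is. -/
theorem isGorenstein_of_irrelevant [IsNoetherianRing R] (h0 : IsField (𝒜 0))
    [(HomogeneousIdeal.irrelevant 𝒜).toIdeal.IsMaximal]
    (h : IsGorensteinLocal (Localization.AtPrime (HomogeneousIdeal.irrelevant 𝒜).toIdeal)) :
    IsGorenstein R := by
  obtain ⟨-, d, hd⟩ := h
  refine ⟨inferInstance, fun p _ => ?_⟩
  refine isGorensteinLocal_localization_of_subsingleton (d := d + 1) (fun I => ?_) p
  refine ExtMod.subsingleton_of_prime ⊥ _ (fun p hp _ => ?_) _ fun r hr x => by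
    rw [(Submodule.mem_bot R).mp hr, zero_smul]
  refine ExtMod.subsingleton_of_isPrime_isHomogeneous 𝒜 (d := d) (fun q _ hq j hj => ?_) hp
    (by omega)
  obtain ⟨s, hs, hsE⟩ := ExtMod.exists_notMem_smul_eq_zero _ hd (R ⧸ q) hj
  exact ExtMod.subsingleton_of_isHomogeneous 𝒜 h0 hq hs hsE

end HomogeneousCore

/-! ### The numerical argument and the conclusion -/

section Main

theorem IsLocalOrGraded.isMaximal {R : Type u} [CommRing R] {m : Ideal R}
    (h : IsLocalOrGraded R m) : m.IsMaximal := by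
  cases h with
  | ofLocal => infer_instance
  | ofGraded 𝒜 h0 => exact isMaximal_irrelevant 𝒜 h0

theorem IsLocalOrGraded.isGorenstein {R : Type u} [CommRing R] {m : Ideal R}
    (h : IsLocalOrGraded R m) (hCM : IsCohenMacaulay R) (h1 : cohenMacaulayType R m ≤ 1) :
    IsGorenstein R := by
  have hm := h.isMaximal
  have hN := hCM.1
  have hG := isGorensteinLocal_of_cohenMacaulayType_le_one m (hCM.2 m) h1
  cases h with
  | ofLocal =>
    refine ⟨hN, fun p hp => ?_⟩
    obtain rfl := IsLocalRing.eq_maximalIdeal hp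
    exact hG
  | ofGraded 𝒜 h0 => exact isGorenstein_of_irrelevant 𝒜 h0 hG

/-- Nonnegativity of the left side of `h` gives `1 ≤ rA * rB`, so both types are at least 1. The
products bounded below in `h1` and `h2` sum to `2 * (rA * rB - 1)`, which is at most `rA * rB - 1`
only if `rA * rB ≤ 1`. -/
theorem type_eq_one_of_inequality {rA rB : ℕ} {eA eB : ℝ} (hA : (rA : ℝ) + 1 ≤ eA)
    (hB : (rB : ℝ) + 1 ≤ eB) {γ₁ γ₂ : ℝ} (hγ₁ : 0 ≤ γ₁) (hγ₂ : 0 ≤ γ₂) (hrA : (rA : ℝ) ≤ γ₁ + 1)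
    (hrB : (rB : ℝ) ≤ γ₂ + 1) (h : eB * γ₁ + eA * γ₂ ≤ (rA : ℝ) * (rB : ℝ) - 1) :
    rA = 1 ∧ rB = 1 ∧ γ₁ = 0 ∧ γ₂ = 0 := by
  have hpos : (1 : ℝ) ≤ (rA : ℝ) * rB := by
    have h1 : 0 ≤ eB * γ₁ := mul_nonneg (by linarith [rB.cast_nonneg (α := ℝ)]) hγ₁
    have h2 : 0 ≤ eA * γ₂ := mul_nonneg (by linarith [rA.cast_nonneg (α := ℝ)]) hγ₂
    linarith
  have hpos' : 0 < rA * rB := by exact_mod_cast (zero_lt_one.trans_le hpos)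
  have hx : 1 ≤ rA := Nat.pos_of_mul_pos_right hpos'
  have hy : 1 ≤ rB := Nat.pos_of_mul_pos_left hpos'
  have hx' : (1 : ℝ) ≤ rA := by exact_mod_cast hx
  have hy' : (1 : ℝ) ≤ rB := by exact_mod_cast hy
  have h1 : ((rB : ℝ) + 1) * (rA - 1) ≤ eB * γ₁ :=
    mul_le_mul hB (by linarith) (by linarith) (by linarith)
  have h2 : ((rA : ℝ) + 1) * (rB - 1) ≤ eA * γ₂ :=
    mul_le_mul hA (by linarith) (by linarith) (by linarith)
  have h3 : rA * rB ≤ 1 := by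
    have : (rA : ℝ) * rB ≤ 1 := by linarith
    exact_mod_cast this
  have hA1 : rA = 1 := Nat.eq_one_of_mul_eq_one_right (le_antisymm h3 hpos')
  have hB1 : rB = 1 := Nat.eq_one_of_mul_eq_one_left (le_antisymm h3 hpos')
  subst hA1 hB1
  norm_num at hA hB h
  refine ⟨rfl, rfl, ?_, ?_⟩ <;> nlinarith

end Main

theorem mainTheorem10 {A : Type u} {B : Type v} [CommRing A] [CommRing B]
    (mA : Ideal A) (mB : Ideal B)
    (hA : IsLocalOrGraded A mA) (hB : IsLocalOrGraded B mB)
    (hCMA : IsCohenMacaulay A) (hCMB : IsCohenMacaulay B)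
    (heA : 1 < ringMultiplicity A mA) (heB : 1 < ringMultiplicity B mB)
    (γ₁ γ₂ : ℝ) (hγ₁ : 0 ≤ γ₁) (hγ₂ : 0 ≤ γ₂)
    (hrA : (cohenMacaulayType A mA : ℝ) ≤ γ₁ + 1)
    (hrB : (cohenMacaulayType B mB : ℝ) ≤ γ₂ + 1)
    (hineq : (ringMultiplicity B mB : ℝ) * γ₁ + (ringMultiplicity A mA : ℝ) * γ₂ ≤
      (cohenMacaulayType A mA : ℝ) * (cohenMacaulayType B mB : ℝ) - 1) :
    IsGorenstein A ∧ IsGorenstein B ∧ γ₁ = 0 ∧ γ₂ = 0 := by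
  have hmA := hA.isMaximal
  have hmB := hB.isMaximal
  have hNA := hCMA.1
  have hNB := hCMB.1
  have h1 := cohenMacaulayType_add_one_le mA (hCMA.2 mA) heA
  have h2 := cohenMacaulayType_add_one_le mB (hCMB.2 mB) heB
  obtain ⟨hA1, hB1, hγ⟩ := type_eq_one_of_inequality (by exact_mod_cast h1) (by exact_mod_cast h2)
    hγ₁ hγ₂ hrA hrB hineq
  exact ⟨hA.isGorenstein hCMA hA1.le, hB.isGorenstein hCMB hB1.le, hγ⟩
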